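/- For a subset $K$ and a subset $B$ of a normed space, let $M(K,B)\in\{0,1,2,\dots\}\cup\{\infty\}$ be the packing number, i.e. the supremum of the cardinalities of sets $S\subset K$ such that the interiors of the translates $x+B$, $x\in S$, are pairwise disjoint. Logarithms are to the base $2$, with $\log\infty=\infty$. For a real normed space $X$ with dual $X^*$ and a set $A\subset X$, let $A^\circ=\{u\in X^*:\sup_{x\in A}u(x)\le 1\}$. The $K$-convexity constant $K(X)\in[0,\infty]$ of $X$ is the supremum over $n$ of the operator norms, on $L_2(\{-1,1\}^n;X)$ with the uniform probability measure, of the Rademacher projections $f\mapsto\sum_{i=1}^n r_i\,\mathbb E[r_i f]$, where $r_i(\omega)=\omega_i$; the space $X$ is $K$-convex if $K(X)<\infty$. **Theorem.** For every $\kappa\in[0,\infty)$ there are $a,b\ge 1$, depending only on $\kappa$, such that the following holds. Let $X$ be a real normed space (of finite or infinite dimension) which is $K$-convex with $K(X)\le\kappa$, and let $B$ be its closed unit ball. Then for every nonempty convex set $T\subset X$ that is symmetric ($T=-T$) and every $\varepsilon>0$, $$b^{-1}\log M(B^\circ,a\varepsilon T^\circ)\ \le\ \log M(T,\varepsilon B)\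 \le\ b\,\log M(B^\circ,a^{-1}\varepsilon T^\circ).$$ -/

import Mathlib

open scoped NNReal ENNReal Pointwise

noncomputable section

/-- The packing number `M(K, B)`, an extended natural number: the supremum of the numbers of
translates of `B` by (distinct) elements of `K` whose interiors are pairwise disjoint. -/
def packingNumber {E : Type*} [AddCommGroup E] [TopologicalSpace E] (K B : Set E) : ℕ∞ :=
  ⨆ (S : Set E) (_ : S ⊆ K) (_ : S.PairwiseDisjoint (fun x => interior (x +ᵥ B))), S.encard

/-- The logarithm to the base 2, with `log 0 = -∞` and `log ∞ = ∞`. -/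
def logTwo (N : ℕ∞) : EReal :=
  ENNReal.log (N : ℝ≥0∞) / ((Real.log 2 : ℝ) : EReal)

/-- The `i`-th Rademacher function on the cube `{-1, 1}ⁿ`, i.e. the `i`-th coordinate. -/
def rademacher {n : ℕ} (i : Fin n) (ω : Fin n → ℤˣ) : ℝ := ((ω i : ℤ) : ℝ)

/-- The average of a function over the cube `{-1, 1}ⁿ` (the integral for the uniform
probability measure). -/
def cubeMean {n : ℕ} {X : Type*} [AddCommGroup X] [Module ℝ X] (f : (Fin n → ℤˣ) → X) : X :=
  ((2 : ℝ) ^ n)⁻¹ • ∑ ω, f ω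

/-- The norm of `L₂({-1, 1}ⁿ; X)`. -/
def cubeL2Norm {n : ℕ} {X : Type*} [NormedAddCommGroup X] (f : (Fin n → ℤˣ) → X) : ℝ :=
  Real.sqrt (cubeMean fun ω => ‖f ω‖ ^ 2)

/-- The (vector valued) Rademacher projection, `f ↦ ∑ i, r_i 𝔼[r_i f]`. -/
def rademacherProj {n : ℕ} {X : Type*} [AddCommGroup X] [Module ℝ X]
    (f : (Fin n → ℤˣ) → X) : (Fin n → ℤˣ) → X :=
  fun ω => ∑ i, rademacher i ω • cubeMean (fun ω' => rademacher i ω' • f ω')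

/-- The K-convexity constant `K(X) ∈ [0, ∞]`: the supremum over `n` of the norms of the Rademacher
projections on `L₂({-1, 1}ⁿ; X)`, i.e. the least common bound of these operators.
The space `X` is K-convex when it is finite. -/
def kConvexityConst (X : Type*) [NormedAddCommGroup X] [NormedSpace ℝ X] : ℝ≥0∞ :=
  ⨅ (C : ℝ≥0) (_ : ∀ (n : ℕ) (f : (Fin n → ℤˣ) → X),
    cubeL2Norm (rademacherProj f) ≤ C * cubeL2Norm f), (C : ℝ≥0∞)

end

/-!
The Rademacher averages of a K-convex space, and by duality those of its dual, are controlled, which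
excludes `ℓ₁`-like behaviour: for some `n` and `θ < 1` depending only on `κ`, any `2ⁿ` vectors of
the unit ball of `X` or `X*` have a signed average of norm at most `θ`. Halving a long average of
points repeatedly by such signs (Maurey's empirical method) shows that each point of a convex hull
in the unit ball is close to an average of `m` of the spanning points, with `m` independent of
their number.

If `T` has diameter comparable to `ε`, take a maximal sequence in `T` each term of which is
separated by a single functional of `B°` from the previous ones. Bucketing by the values of the
functionals bounds its length by a multiple of the separation number of `B°` with respect to `T°`,
and every point of `T` is close to the convex hull of the sequence, hence to one of its `m`-fold
averages; so `m` enters as an exponent. Exchanging `T` and `B°` gives the other inequality. For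
general `T` this is applied to the truncations `T ∩ ρB` with `ρ = 128ε`, and the resulting bounds
telescope over the scales `ε, 256ε, 256²ε, …`.
-/

section sepNum

/-- The separation number: the supremum of the cardinalities of the finite subsets of `K` no two
distinct points of which differ by an element of `D`. For `D = 2B` it is the packing number of `K`
by translates of an open convex symmetric set `B`; unlike `packingNumber` it involves no
topology. -/
noncomputable def sepNum {E : Type*} [AddCommGroup E] (K D : Set E) : ℕ∞ :=
  ⨆ (S : Finset E) (_ : (S : Set E) ⊆ K) (_ : (S : Set E).Pairwise fun x y => x - y ∉ D),
    (S.card : ℕ∞)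

variable {E : Type*} [AddCommGroup E] {K K' D D' : Set E}

theorem sepNum_le_iff {N : ℕ∞} : sepNum K D ≤ N ↔ ∀ S : Finset E, (S : Set E) ⊆ K →
    (S : Set E).Pairwise (fun x y => x - y ∉ D) → (S.card : ℕ∞) ≤ N := by
  simp only [sepNum, iSup_le_iff]

theorem card_le_sepNum {S : Finset E} (hK : (S : Set E) ⊆ K)
    (hD : (S : Set E).Pairwise fun x y => x - y ∉ D) : (S.card : ℕ∞) ≤ sepNum K D :=
  sepNum_le_iff.1 le_rfl S hK hD

theorem card_le_sepNum_of_family {ι : Type*} {I : Finset ι} {f : ι → E} (h0 : (0 : E) ∈ D)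
    (hK : ∀ i ∈ I, f i ∈ K) (hD : (I : Set ι).Pairwise fun i j => f i - f j ∉ D) :
    (I.card : ℕ∞) ≤ sepNum K D := by
  classical
  have hinj : Set.InjOn f I := fun i hi j hj hij => by
    by_contra hne
    exact hD hi hj hne (by simpa [hij] using h0)
  rw [← Finset.card_image_of_injOn hinj]
  apply card_le_sepNum
  · simpa [Set.subset_def] using hK
  · rw [Finset.coe_image, hinj.pairwise_image]
    exact hD

theorem sepNum_le_of_map {F : Type*} [AddCommGroup F] {L C : Set F} (φ : E → F)
    (h0 : (0 : F) ∈ C) (hK : Set.MapsTo φ K L)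
    (hD : ∀ x ∈ K, ∀ y ∈ K, φ x - φ y ∈ C → x - y ∈ D) : sepNum K D ≤ sepNum L C :=
  sepNum_le_iff.2 fun _ hSK hSD => card_le_sepNum_of_family h0 (fun _ hx => hK (hSK hx))
    fun x hx y hy hxy h => hSD hx hy hxy (hD x (hSK hx) y (hSK hy) h)

theorem sepNum_mono (h0 : (0 : E) ∈ D') (hK : K ⊆ K') (hD : D' ⊆ D) :
    sepNum K D ≤ sepNum K' D' :=
  sepNum_le_of_map id h0 hK fun _ _ _ _ h => hD h

theorem one_le_sepNum (hK : K.Nonempty) : 1 ≤ sepNum K D := by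
  obtain ⟨x, hx⟩ := hK
  simpa using card_le_sepNum (S := {x}) (K := K) (D := D) (by simpa using hx) (by simp)

theorem sepNum_le_one_iff (h0 : (0 : E) ∈ D) (hneg : ∀ x ∈ D, -x ∈ D) :
    sepNum K D ≤ 1 ↔ ∀ x ∈ K, ∀ y ∈ K, x - y ∈ D := by
  classical
  constructor
  · intro h x hx y hy
    by_contra hxy
    have hne : x ≠ y := by
      rintro rfl
      exact hxy (by simpa using h0)
    have hyx : y - x ∉ D := fun h' => hxy (by simpa using hneg _ h')
    have hcard := (card_le_sepNum (S := {x, y}) (K := K) (D := D)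
      (by simp [Set.insert_subset_iff, hx, hy]) (by simp [Set.pairwise_insert, hxy, hyx])).trans h
    rw [Finset.card_pair hne] at hcard
    exact absurd hcard (by norm_num)
  · refine fun h => sepNum_le_iff.2 fun S hSK hSD => ?_
    have : S.card ≤ 1 := Finset.card_le_one.2 fun x hx y hy => by
      by_contra hne
      exact hSD hx hy hne (h x (hSK hx) y (hSK hy))
    exact_mod_cast this

theorem sepNum_le_encard_of_cover {C Z : Set E} (hcover : ∀ x ∈ K, ∃ z ∈ Z, x - z ∈ C)
    (hD : ∀ c ∈ C, ∀ c' ∈ C, c - c' ∈ D) : sepNum K D ≤ Z.encard := by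
  choose! f hfZ hfC using hcover
  refine sepNum_le_iff.2 fun S hSK hSD => ?_
  have hinj : Set.InjOn f S := fun x hx y hy hxy => by
    by_contra hne
    refine hSD hx hy hne ?_
    simpa [hxy] using hD _ (hfC x (hSK hx)) _ (hfC y (hSK hy))
  calc (S.card : ℕ∞) = (f '' S).encard := by
        rw [hinj.encard_image, Set.encard_coe_eq_coe_finsetCard]
    _ ≤ Z.encard := Set.encard_le_encard (Set.image_subset_iff.2 fun x hx => hfZ x (hSK hx))

theorem exists_separated_net (h0 : (0 : E) ∈ D) (hneg : ∀ x ∈ D, -x ∈ D) (S : Finset E) :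
    ∃ S' ⊆ S, (S' : Set E).Pairwise (fun x y => x - y ∉ D) ∧
      ∀ x ∈ S, ∃ y ∈ S', x - y ∈ D := by
  classical
  obtain ⟨S', hmax⟩ := (S.powerset.filter
    fun S' : Finset E => (S' : Set E).Pairwise fun x y => x - y ∉ D).exists_maximal ⟨∅, by simp⟩
  obtain ⟨hS'S, hS'D⟩ := Finset.mem_filter.1 hmax.prop
  rw [Finset.mem_powerset] at hS'S
  refine ⟨S', hS'S, hS'D, fun x hx => ?_⟩
  by_contra! hfar
  have hxS' : x ∈ S' := hmax.le_of_ge (y := insert x S')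
    (by
      simp only [Finset.mem_filter, Finset.mem_powerset, Finset.coe_insert]
      exact ⟨Finset.insert_subset hx hS'S, hS'D.insert fun y hy _ =>
        ⟨hfar y hy, fun h => hfar y hy (by simpa using hneg _ h)⟩⟩)
    (Finset.subset_insert x S') (Finset.mem_insert_self x S')
  exact hfar x hxS' (by simpa using h0)

theorem sepNum_le_mul (h0 : (0 : E) ∈ D) (h0' : (0 : E) ∈ D') (hneg' : ∀ x ∈ D', -x ∈ D') :
    sepNum K D ≤ sepNum K D' * sepNum ((K - K) ∩ D') D := by
  classical
  refine sepNum_le_iff.2 fun S hSK hSD => ?_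
  obtain ⟨S', hS'S, hS'D, hnear⟩ := exists_separated_net h0' hneg' S
  choose! π hπ hπD using hnear
  have hfiber (y) (hy : y ∈ S') :
      ((S.filter fun x => π x = y).card : ℕ∞) ≤ sepNum ((K - K) ∩ D') D := by
    refine card_le_sepNum_of_family (f := fun x => x - y) h0 (fun x hx => ?_)
      fun x hx x' hx' hne => ?_
    · obtain ⟨hxS, rfl⟩ := Finset.mem_filter.1 hx
      exact ⟨Set.sub_mem_sub (hSK hxS) (hSK (hS'S hy)), hπD x hxS⟩
    · simpa using hSD (Finset.mem_filter.1 hx).1 (Finset.mem_filter.1 hx').1 hne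
  calc (S.card : ℕ∞) = ∑ y ∈ S', ((S.filter fun x => π x = y).card : ℕ∞) := by
        rw [Finset.card_eq_sum_card_fiberwise fun x hx => hπ x hx, Nat.cast_sum]
    _ ≤ ∑ _y ∈ S', sepNum ((K - K) ∩ D') D := Finset.sum_le_sum hfiber
    _ = S'.card * sepNum ((K - K) ∩ D') D := by simp
    _ ≤ sepNum K D' * sepNum ((K - K) ∩ D') D := by
        gcongr
        exact card_le_sepNum (fun x hx => hSK (hS'S hx)) hS'D

theorem sepNum_mul_le {F G : Type*} [AddCommGroup F] [AddCommGroup G] {L C : Set F} {M A : Set G}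
    (φ : E → F → G) (h0 : (0 : G) ∈ A) (hM : ∀ x ∈ K, ∀ y ∈ L, φ x y ∈ M)
    (hsep : ∀ x ∈ K, ∀ x' ∈ K, ∀ y ∈ L, ∀ y' ∈ L, φ x y - φ x' y' ∈ A → x - x' ∈ D)
    (hsep' : ∀ x ∈ K, ∀ y ∈ L, ∀ y' ∈ L, φ x y - φ x y' ∈ A → y - y' ∈ C) :
    sepNum K D * sepNum L C ≤ sepNum M A := by
  have hprod (S : Finset E) (hSK : (S : Set E) ⊆ K)
      (hSD : (S : Set E).Pairwise fun x y => x - y ∉ D) (S' : Finset F) (hS'L : (S' : Set F) ⊆ L)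
      (hS'C : (S' : Set F).Pairwise fun x y => x - y ∉ C) :
      (S.card * S'.card : ℕ∞) ≤ sepNum M A := by
    rw [← Nat.cast_mul, ← Finset.card_product]
    refine card_le_sepNum_of_family (f := fun z => φ z.1 z.2) h0 (fun z hz => ?_) ?_
    · obtain ⟨hx, hy⟩ := Finset.mem_product.1 hz
      exact hM _ (hSK hx) _ (hS'L hy)
    · rintro ⟨x, y⟩ hz ⟨x', y'⟩ hz' hne hA
      obtain ⟨hx, hy⟩ := Finset.mem_product.1 hz
      obtain ⟨hx', hy'⟩ := Finset.mem_product.1 hz'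
      by_cases hxx' : x = x'
      · subst hxx'
        exact hS'C hy hy' (by simpa using hne) (hsep' x (hSK hx) y (hS'L hy) y' (hS'L hy') hA)
      · exact hSD hx hx' hxx' (hsep x (hSK hx) x' (hSK hx') y (hS'L hy) y' (hS'L hy') hA)
  simp only [sepNum, ENat.iSup_mul, ENat.mul_iSup, iSup_le_iff]
  exact fun S' hS'L hS'C S hSK hSD => hprod S hSK hSD S' hS'L hS'C

end sepNum

section minimax

theorem exists_forall_le_of_forall_exists_le {V W : Type*} [AddCommGroup V] [Module ℝ V]
    [TopologicalSpace V] [IsTopologicalAddGroup V] [ContinuousSMul ℝ V] [AddCommGroup W]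
    [Module ℝ W] [TopologicalSpace W] [IsTopologicalAddGroup W] [ContinuousSMul ℝ W]
    {A : Set V} {B : Set W} {f : V → W → ℝ} {r : ℝ} (hA : A.Nonempty) (hAc : IsCompact A)
    (hAconv : Convex ℝ A) (hBconv : Convex ℝ B)
    (hfA : ∀ y ∈ B, LowerSemicontinuousOn (fun x => f x y) A)
    (hfA' : ∀ y ∈ B, QuasiconvexOn ℝ A fun x => f x y)
    (hfB : ∀ x ∈ A, UpperSemicontinuousOn (f x) B) (hfB' : ∀ x ∈ A, QuasiconcaveOn ℝ B (f x))
    (h : ∀ y ∈ B, ∃ x ∈ A, f x y ≤ r) : ∃ x ∈ A, ∀ y ∈ B, f x y ≤ r := by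
  by_contra! hlt
  obtain ⟨u, hu⟩ : ∃ u : Finset B, ∀ x ∈ A, ∃ y ∈ u, r < f x y := by
    rw [← LowerSemicontinuousOn.inter_biInter_preimage_Iic_eq_empty_iff_exists_finset hAc hfA,
      Set.eq_empty_iff_forall_notMem]
    rintro x ⟨hx, hx'⟩
    obtain ⟨y, hy, hxy⟩ := hlt x hx
    exact hxy.not_ge (Set.mem_iInter₂.1 hx' y hy)
  obtain ⟨y, hy, hxy⟩ := Sion.exists_lt_iInf_of_lt_iInf_of_finite hA hAc hfA hfA' hBconv hfB hfB'
    hAconv (u.finite_toSet.image Subtype.val) (Subtype.coe_image_subset B u)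
    fun x hx => by simpa using hu x hx
  obtain ⟨x, hx, hle⟩ := h y hy
  exact (hxy x hx).not_ge hle

end minimax

section averages

variable {E : Type*} [AddCommGroup E] [Module ℝ E]

/-- The averages of `m` terms, each of which is `0` or an element of `A`. -/
def averages (m : ℕ) (A : Set E) : Set E :=
  (fun v : Fin m → E => (m : ℝ)⁻¹ • ∑ j, v j) '' Set.univ.pi fun _ => insert 0 A

/-- `K` has `m`-term average approximation up to `D` if every convex combination of elements of
`K` is the average of `m` terms, each either one of these elements or `0`, up to an error in `D`.
For `D` a small multiple of a unit ball `K` this is the conclusion of Maurey's empirical method. -/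
def HasAverageApprox (m : ℕ) (K D : Set E) : Prop :=
  ∀ A ⊆ K, ∀ x ∈ convexHull ℝ A, ∃ y ∈ averages m A, x - y ∈ D

theorem encard_averages_le (m : ℕ) (A : Finset E) :
    (averages m (A : Set E)).encard ≤ ((A.card + 1) ^ m : ℕ) := by
  classical
  refine (Set.encard_image_le _ _).trans ?_
  have : (Set.univ.pi fun _ : Fin m => insert 0 (A : Set E)) =
      ((Fintype.piFinset fun _ => insert 0 A : Finset (Fin m → E)) : Set (Fin m → E)) := by
    simp
  rw [this, Set.encard_coe_eq_coe_finsetCard, Fintype.card_piFinset_const]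
  gcongr
  exact Finset.card_insert_le 0 A

end averages

section pairing

/-- The polar of `K` at level `s`, i.e. the dilate `s • K°`, for a pairing `β`. The absolute value
makes it symmetric; it gives the one-sided polar when `K` is symmetric. -/
def scaledPolar {E F : Type*} [AddCommGroup E] [Module ℝ E] [AddCommGroup F] [Module ℝ F]
    (β : E →ₗ[ℝ] F →ₗ[ℝ] ℝ) (s : ℝ) (K : Set E) : Set F :=
  {y | ∀ x ∈ K, |β x y| ≤ s}

variable {E F : Type*} [AddCommGroup E] [Module ℝ E] [AddCommGroup F] [Module ℝ F]
  {β : E →ₗ[ℝ] F →ₗ[ℝ] ℝ} {K : Set E} {L : Set F} {s t : ℝ}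

theorem zero_mem_scaledPolar (hs : 0 ≤ s) : (0 : F) ∈ scaledPolar β s K := fun x _ => by
  simpa using hs

theorem neg_mem_scaledPolar {y : F} (hy : y ∈ scaledPolar β s K) : -y ∈ scaledPolar β s K :=
  fun x hx => by simpa using hy x hx

theorem scaledPolar_mono (hst : s ≤ t) : scaledPolar β s K ⊆ scaledPolar β t K :=
  fun _ hy x hx => (hy x hx).trans hst

theorem add_mem_scaledPolar {y z : F} (hy : y ∈ scaledPolar β s K) (hz : z ∈ scaledPolar β t K) :
    y + z ∈ scaledPolar β (s + t) K := fun x hx => by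
  rw [map_add]
  exact (abs_add_le _ _).trans (add_le_add (hy x hx) (hz x hx))

theorem sub_mem_scaledPolar {y z : F} (hy : y ∈ scaledPolar β s K) (hz : z ∈ scaledPolar β t K) :
    y - z ∈ scaledPolar β (s + t) K := by
  rw [sub_eq_add_neg]
  exact add_mem_scaledPolar hy (neg_mem_scaledPolar hz)

theorem smul_mem_scaledPolar_iff {c : ℝ} (hc : 0 < c) {y : F} :
    c • y ∈ scaledPolar β (c * s) K ↔ y ∈ scaledPolar β s K := by
  simp only [scaledPolar, Set.mem_ofPred_eq, map_smul, smul_eq_mul, abs_mul, abs_of_pos hc]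
  exact forall₂_congr fun x _ => mul_le_mul_iff_right₀ hc

theorem smul_scaledPolar {c : ℝ} (hc : 0 < c) :
    c • scaledPolar β s K = scaledPolar β (c * s) K := by
  ext y
  rw [Set.mem_smul_set_iff_inv_smul_mem₀ hc.ne', ← smul_mem_scaledPolar_iff hc,
    smul_inv_smul₀ hc.ne']

theorem convex_scaledPolar : Convex ℝ (scaledPolar β s K) := by
  have hinter : scaledPolar β s K = ⋂ x ∈ K, β x ⁻¹' Set.Icc (-s) s := by
    ext y
    simp [scaledPolar, abs_le]
  rw [hinter]
  exact convex_iInter₂ fun x _ => (convex_Icc _ _).linear_preimage (β x)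

theorem exists_mem_convexHull_sub_mem_scaledPolar {ι : Type*} [Finite ι] (hLne : L.Nonempty)
    (hLconv : Convex ℝ L) (hLneg : ∀ y ∈ L, -y ∈ L) (k : ι → E) (x : E)
    (h : ∀ y ∈ L, ∃ i, β (x - k i) y < s) :
    ∃ c ∈ convexHull ℝ (Set.range k), x - c ∈ scaledPolar β.flip s L := by
  classical
  have := Fintype.ofFinite ι
  have : Nonempty ι := by
    obtain ⟨y, hy⟩ := hLne
    exact ⟨(h y hy).choose⟩
  let Φ : F →ₗ[ℝ] ι → ℝ := LinearMap.pi fun i => β (x - k i)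
  have hlin (w : ι → ℝ) : IsLinearMap ℝ fun v : ι → ℝ => ∑ i, w i * v i :=
    ⟨fun v v' => by simp [mul_add, Finset.sum_add_distrib],
      fun c v => by simp [Finset.mul_sum, mul_left_comm]⟩
  obtain ⟨w, hw, hwL⟩ := exists_forall_le_of_forall_exists_le (r := s) (B := Φ '' L)
    (f := fun w v : ι → ℝ => ∑ i, w i * v i)
    ⟨_, single_mem_stdSimplex ℝ (Classical.arbitrary ι)⟩ (isCompact_stdSimplex ℝ ι)
    (convex_stdSimplex ℝ ι) (hLconv.linear_image Φ)
    (fun v _ => (by fun_prop : Continuous _).continuousOn.lowerSemicontinuousOn)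
    (fun v _ => by
      simp only [mul_comm _ (v _)]
      exact ((hlin v).mk'.convexOn (convex_stdSimplex ℝ ι)).quasiconvexOn)
    (fun w _ => (by fun_prop : Continuous _).continuousOn.upperSemicontinuousOn)
    (fun w _ => ((hlin w).mk'.concaveOn (hLconv.linear_image Φ)).quasiconcaveOn)
    (by
      rintro _ ⟨y, hy, rfl⟩
      obtain ⟨i, hi⟩ := h y hy
      exact ⟨Pi.single i 1, single_mem_stdSimplex ℝ i, by simpa [Φ, Pi.single_apply] using hi.le⟩)
  refine ⟨∑ i, w i • k i, (mem_convexHull_of_exists_fintype w k hw.1 hw.2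
    (Set.mem_range_self ·) rfl), fun y hy => ?_⟩
  have hle (y) (hy : y ∈ L) : β (x - ∑ i, w i • k i) y ≤ s := by
    refine le_of_eq_of_le ?_ (hwL _ ⟨y, hy, rfl⟩)
    have : x - ∑ i, w i • k i = ∑ i, w i • (x - k i) := by
      simp only [smul_sub, Finset.sum_sub_distrib, ← Finset.sum_smul, hw.2, one_smul]
    simp [this, Φ]
  exact abs_le'.2
    ⟨hle y hy, by simpa only [map_neg, LinearMap.flip_apply] using hle (-y) (hLneg y hy)⟩

end pairing

section duality

variable {E F : Type*} [AddCommGroup E] [Module ℝ E] [AddCommGroup F] [Module ℝ F]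
  {β : E →ₗ[ℝ] F →ₗ[ℝ] ℝ} {K : Set E} {L : Set F} {r s : ℝ} {N m R : ℕ}

/-- A convexly separated sequence `k 0, …, k (N - 1)` in `K`: each term is separated from all the
preceding ones, hence from their convex hull, by a single functional `l i ∈ L`. -/
structure IsConvexlySeparated (β : E →ₗ[ℝ] F →ₗ[ℝ] ℝ) (r : ℝ) (K : Set E) (L : Set F) {N : ℕ}
    (k : Fin N → E) (l : Fin N → F) : Prop where
  left_mem : ∀ i, k i ∈ K
  right_mem : ∀ i, l i ∈ L
  le_apply : ∀ i, ∀ j < i, r ≤ β (k i - k j) (l i)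

theorem IsConvexlySeparated.snoc {k : Fin N → E} {l : Fin N → F}
    (h : IsConvexlySeparated β r K L k l) {x : E} {y : F} (hx : x ∈ K) (hy : y ∈ L)
    (hxy : ∀ i, r ≤ β (x - k i) y) :
    IsConvexlySeparated β r K L (Fin.snoc k x : Fin (N + 1) → E)
      (Fin.snoc l y : Fin (N + 1) → F) where
  left_mem i := by
    cases i using Fin.lastCases with
    | last => simpa using hx
    | cast i => simpa using h.left_mem i
  right_mem i := by
    cases i using Fin.lastCases with
    | last => simpa using hy
    | cast i => simpa using h.right_mem i
  le_apply i j hij := by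
    obtain ⟨j, rfl⟩ := Fin.exists_castSucc_eq.2 (hij.trans_le (Fin.le_last i)).ne
    cases i using Fin.lastCases with
    | last => simpa using hxy j
    | cast i => simpa using h.le_apply i j (Fin.castSucc_lt_castSucc_iff.1 hij)

theorem exists_maximal_isConvexlySeparated {B : ℕ}
    (hB : ∀ (N : ℕ) (k : Fin N → E) (l : Fin N → F), IsConvexlySeparated β r K L k l → N ≤ B) :
    ∃ (N : ℕ) (k : Fin N → E) (l : Fin N → F), IsConvexlySeparated β r K L k l ∧
      ∀ x ∈ K, ∀ y ∈ L, ∃ i, β (x - k i) y < r := by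
  by_contra! hext
  have hall (N : ℕ) :
      ∃ (k : Fin N → E) (l : Fin N → F), IsConvexlySeparated β r K L k l := by
    induction N with
    | zero => exact ⟨Fin.elim0, Fin.elim0, ⟨Fin.rec0, Fin.rec0, Fin.rec0⟩⟩
    | succ N ih =>
      obtain ⟨k, l, h⟩ := ih
      obtain ⟨x, hx, y, hy, hxy⟩ := hext N k l h
      exact ⟨_, _, h.snoc hx hy hxy⟩
  obtain ⟨k, l, h⟩ := hall (B + 1)
  exact (Nat.lt_succ_self B).not_ge (hB _ k l h)

/-- Two indices whose numbers `β (k i) (l i)` agree up to `s` have functionals which are separated: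
the value at `k j` of `l i - l j`, for `j < i`, is at least `2 * s` minus this error. Sorting the
numbers into intervals of length `s` therefore leaves at most `sepNum L (scaledPolar β s K)` indices
in each of them. -/
theorem IsConvexlySeparated.le_mul_sepNum {k : Fin N → E} {l : Fin N → F}
    (h : IsConvexlySeparated β (2 * s) K L k l) (hs : 0 < s)
    (hR : ∀ x ∈ K, ∀ y ∈ L, |β x y| ≤ R * s) :
    (N : ℕ∞) ≤ (2 * R + 1 : ℕ) * sepNum L (scaledPolar β s K) := by
  classical
  let bucket (i : Fin N) : ℤ := ⌊β (k i) (l i) / s⌋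
  have hbucket : ∀ i ∈ Finset.univ, bucket i ∈ Finset.Icc (-(R : ℤ)) R := fun i _ => by
    have hle : |β (k i) (l i) / s| ≤ R := by
      rw [abs_div, abs_of_pos hs, div_le_iff₀ hs]
      exact hR _ (h.left_mem i) _ (h.right_mem i)
    rw [abs_le] at hle
    rw [Finset.mem_Icc, Int.le_floor]
    exact ⟨by exact_mod_cast hle.1, Int.floor_le_iff.2 (by push_cast; linarith)⟩
  have hsep {i j : Fin N} (hji : j < i) (hb : bucket i = bucket j) :
      l i - l j ∉ scaledPolar β s K := fun hmem => by
    have hclose := (abs_lt.1 (Int.abs_sub_lt_one_of_floor_eq_floor hb)).2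
    rw [← sub_div, div_lt_one hs] at hclose
    have hsep := h.le_apply i j hji
    have hsmall := (abs_le.1 (hmem (k j) (h.left_mem j))).1
    simp only [map_sub, LinearMap.sub_apply] at hsep hsmall
    linarith
  have hfiber (b : ℤ) : ((Finset.univ.filter fun i => bucket i = b).card : ℕ∞) ≤
      sepNum L (scaledPolar β s K) := by
    refine card_le_sepNum_of_family (f := l) (zero_mem_scaledPolar hs.le)
      (fun i _ => h.right_mem i) fun i hi j hj hij hmem => ?_
    have hb : bucket i = bucket j :=
      (Finset.mem_filter.1 hi).2.trans (Finset.mem_filter.1 hj).2.symm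
    rcases hij.lt_or_gt with hlt | hlt
    · exact hsep hlt hb.symm (by simpa using neg_mem_scaledPolar hmem)
    · exact hsep hlt hb hmem
  calc (N : ℕ∞) = ∑ b ∈ Finset.Icc (-(R : ℤ)) R,
        ((Finset.univ.filter fun i => bucket i = b).card : ℕ∞) := by
        rw [← Nat.cast_sum, ← Finset.card_eq_sum_card_fiberwise hbucket, Finset.card_univ,
          Fintype.card_fin]
    _ ≤ ∑ _b ∈ Finset.Icc (-(R : ℤ)) R, sepNum L (scaledPolar β s K) :=
        Finset.sum_le_sum fun b _ => hfiber b
    _ = (2 * R + 1 : ℕ) * sepNum L (scaledPolar β s K) := by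
        rw [Finset.sum_const, Int.card_Icc, nsmul_eq_mul]
        congr
        lia

theorem sepNum_le_pow_of_forall_exists_lt (happrox : HasAverageApprox m K (scaledPolar β.flip r L))
    (hLne : L.Nonempty) (hLconv : Convex ℝ L) (hLneg : ∀ y ∈ L, -y ∈ L) {k : Fin N → E}
    (hk : ∀ i, k i ∈ K) (hmax : ∀ x ∈ K, ∀ y ∈ L, ∃ i, β (x - k i) y < r) :
    sepNum K (scaledPolar β.flip (4 * r) L) ≤ ((N + 1) ^ m : ℕ) := by
  classical
  let A : Finset E := Finset.univ.image k
  have hA : (A : Set E) = Set.range k := by simp [A]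
  have hcover (x) (hx : x ∈ K) :
      ∃ z ∈ averages m (A : Set E), x - z ∈ scaledPolar β.flip (2 * r) L := by
    obtain ⟨c, hc, hxc⟩ :=
      exists_mem_convexHull_sub_mem_scaledPolar hLne hLconv hLneg k x (hmax x hx)
    rw [← hA] at hc
    obtain ⟨z, hz, hcz⟩ := happrox A (by simpa [hA, Set.range_subset_iff] using hk) c hc
    exact ⟨z, hz, by simpa [two_mul] using add_mem_scaledPolar hxc hcz⟩
  calc sepNum K (scaledPolar β.flip (4 * r) L) ≤ (averages m (A : Set E)).encard :=
        sepNum_le_encard_of_cover hcover fun c hc c' hc' => by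
          rw [show 4 * r = 2 * r + 2 * r by ring]
          exact sub_mem_scaledPolar hc hc'
    _ ≤ ((A.card + 1) ^ m : ℕ) := encard_averages_le m A
    _ ≤ ((N + 1) ^ m : ℕ) := by
        gcongr
        simpa using Finset.card_image_le (s := Finset.univ) (f := k)

theorem sepNum_le_one_of_sepNum_scaledPolar_le_one (hs : 0 ≤ s) (hLneg : ∀ y ∈ L, -y ∈ L)
    (h : sepNum L (scaledPolar β s K) ≤ 1) : sepNum K (scaledPolar β.flip s L) ≤ 1 := by
  have hL := (sepNum_le_one_iff (zero_mem_scaledPolar hs) fun _ => neg_mem_scaledPolar).1 h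
  refine (sepNum_le_one_iff (zero_mem_scaledPolar hs) fun _ => neg_mem_scaledPolar).2
    fun x hx x' hx' y hy => ?_
  have hhalf (z) (hz : z ∈ K) : |β z y| ≤ s / 2 := by
    have hle := hL y hy (-y) (hLneg y hy) z hz
    rw [sub_neg_eq_add, map_add, ← two_mul, abs_mul, abs_two] at hle
    linarith
  calc |β.flip y (x - x')| ≤ |β x y| + |β x' y| := by simpa using abs_sub (β x y) (β x' y)
    _ ≤ s := by linarith [hhalf x hx, hhalf x' hx']

/-- Duality for separation numbers: a maximal convexly separated sequence in `K` is short because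
its functionals are separated in `L`, while the averages of its terms form a net of `K`. -/
theorem sepNum_scaledPolar_flip_le_pow (hm : m ≠ 0) (hs : 0 < s)
    (happrox : HasAverageApprox m K (scaledPolar β.flip (2 * s) L)) (hLne : L.Nonempty)
    (hLconv : Convex ℝ L) (hLneg : ∀ y ∈ L, -y ∈ L) (hR : ∀ x ∈ K, ∀ y ∈ L, |β x y| ≤ R * s) :
    sepNum K (scaledPolar β.flip (8 * s) L) ≤
      sepNum L (scaledPolar β s K) ^ ((2 * R + 2) * m) := by
  rcases eq_or_ne (sepNum L (scaledPolar β s K)) ⊤ with htop | hfin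
  · rw [htop, ENat.top_pow (by positivity)]
    exact le_top
  obtain ⟨M, hM⟩ := ENat.ne_top_iff_exists.1 hfin
  rcases Nat.lt_or_ge 1 M with hM2 | hM1
  · have hlen (N : ℕ) (k : Fin N → E) (l : Fin N → F)
        (h : IsConvexlySeparated β (2 * s) K L k l) : N ≤ (2 * R + 1) * M := by
      have hle := h.le_mul_sepNum hs hR
      rw [← hM] at hle
      exact_mod_cast hle
    obtain ⟨N, k, l, h, hmax⟩ := exists_maximal_isConvexlySeparated hlen
    have hle := sepNum_le_pow_of_forall_exists_lt happrox hLne hLconv hLneg h.left_mem hmax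
    have hN : N + 1 ≤ M ^ (2 * R + 2) := by
      calc N + 1 ≤ (2 * R + 2) * M := by nlinarith [hlen N k l h]
        _ ≤ 2 ^ (2 * R + 1) * M := by gcongr; exact Nat.lt_two_pow_self
        _ ≤ M ^ (2 * R + 1) * M := by gcongr; exact hM2
        _ = M ^ (2 * R + 2) := (pow_succ M _).symm
    rw [← hM, pow_mul]
    calc sepNum K (scaledPolar β.flip (8 * s) L) ≤ ((N + 1) ^ m : ℕ) := by
          rwa [show 8 * s = 4 * (2 * s) by ring]
      _ ≤ (((M : ℕ∞) ^ (2 * R + 2)) ^ m) := by exact_mod_cast Nat.pow_le_pow_left hN m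
  · have hone : sepNum L (scaledPolar β s K) ≤ 1 := by
      rw [← hM]
      exact_mod_cast hM1
    calc sepNum K (scaledPolar β.flip (8 * s) L) ≤ sepNum K (scaledPolar β.flip s L) :=
          sepNum_mono (zero_mem_scaledPolar hs.le) subset_rfl (scaledPolar_mono (by linarith))
      _ ≤ 1 := sepNum_le_one_of_sepNum_scaledPolar_le_one hs.le hLneg hone
      _ ≤ _ := one_le_pow_of_one_le' (one_le_sepNum hLne) _

end duality

section averages

variable {E : Type*} [AddCommGroup E] [Module ℝ E] {m : ℕ} {A K K' D D' : Set E}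

theorem smul_sum_mem_averages {ι : Type*} {I : Finset ι} {f : ι → E} (hcard : I.card ≤ m)
    (hf : ∀ i ∈ I, f i ∈ insert 0 A) : (m : ℝ)⁻¹ • ∑ i ∈ I, f i ∈ averages m A := by
  obtain ⟨e⟩ : Nonempty (I ↪ Fin m) :=
    Function.Embedding.nonempty_of_card_le (by simpa using hcard)
  let v : Fin m → E := Function.extend e (fun i => f i) 0
  have hv (j) : v j ∈ insert 0 A := by
    by_cases hj : ∃ i, e i = j
    · obtain ⟨i, rfl⟩ := hj
      simpa [v, e.injective.extend_apply] using hf i i.2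
    · simp [v, Function.extend_apply' _ _ _ hj]
  refine ⟨v, fun j _ => hv j, ?_⟩
  change (m : ℝ)⁻¹ • ∑ j, v j = (m : ℝ)⁻¹ • ∑ i ∈ I, f i
  congr 1
  rw [← Finset.sum_coe_sort I f]
  symm
  refine Finset.sum_of_injOn e e.injective.injOn (fun _ _ => by simp) (fun j _ hj => ?_)
    fun i _ => ?_
  · exact Function.extend_apply' _ _ _ (by simpa using hj)
  · exact (e.injective.extend_apply (fun i : I => f i) 0 i).symm

theorem smul_mem_averages {x : E} (hx : x ∈ averages m A) (c : ℝ) :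
    c • x ∈ averages m (c • A) := by
  obtain ⟨v, hv, rfl⟩ := hx
  refine ⟨c • v, fun j _ => ?_, by simp [← Finset.smul_sum, smul_comm c]⟩
  obtain h0 | hA := Set.mem_insert_iff.1 (hv j trivial)
  · simp [h0]
  · exact Set.mem_insert_of_mem _ (Set.smul_mem_smul_set hA)

theorem HasAverageApprox.mono (h : HasAverageApprox m K D) (hK : K' ⊆ K) (hD : D ⊆ D') :
    HasAverageApprox m K' D' := fun A hA x hx => by
  obtain ⟨y, hy, hxy⟩ := h A (hA.trans hK) x hx
  exact ⟨y, hy, hD hxy⟩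

theorem HasAverageApprox.smul (h : HasAverageApprox m K D) {c : ℝ} (hc : c ≠ 0) :
    HasAverageApprox m (c • K) (c • D) := fun A hA x hx => by
  obtain ⟨y, hy, hxy⟩ := h (c⁻¹ • A) ((Set.subset_smul_set_iff₀ hc).1 hA)
    (c⁻¹ • x) (by rw [convexHull_smul]; exact Set.smul_mem_smul_set hx)
  refine ⟨c • y, by simpa [smul_inv_smul₀ hc] using smul_mem_averages hy c, c⁻¹ • x - y, hxy, ?_⟩
  simp [smul_sub, smul_inv_smul₀ hc]

end averages

section BeckConvex

open Metric

/-- Beck's convexity condition (a form of B-convexity): any `P` vectors of the unit ball have a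
signed sum of norm at most `θ * P`. -/
def BeckConvex (Y : Type*) [NormedAddCommGroup Y] (P : ℕ) (θ : ℝ) : Prop :=
  ∀ z : Fin P → Y, (∀ i, ‖z i‖ ≤ 1) → ∃ ω : Fin P → ℤˣ, ‖∑ i, ω i • z i‖ ≤ θ * P

variable {Y : Type*} [NormedAddCommGroup Y] {P Q n : ℕ} {θ η : ℝ}

theorem beckConvex_one (P : ℕ) : BeckConvex Y P 1 := fun z hz =>
  ⟨1, by simpa using norm_sum_le_of_le Finset.univ fun i _ => hz i⟩

theorem BeckConvex.exists_card_filter_le (h : BeckConvex Y (2 * P) θ) {z : Fin (2 * P) → Y}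
    (hz : ∀ i, ‖z i‖ ≤ 1) : ∃ ω : Fin (2 * P) → ℤˣ,
      (Finset.univ.filter fun i => ω i = 1).card ≤ P ∧ ‖∑ i, ω i • z i‖ ≤ θ * (2 * P : ℕ) := by
  obtain ⟨ω, hω⟩ := h z hz
  rcases le_total (Finset.univ.filter fun i => ω i = 1).card P with hcard | hcard
  · exact ⟨ω, hcard, hω⟩
  · refine ⟨-ω, ?_, by simpa [Units.neg_smul] using hω⟩
    have hneg : (Finset.univ.filter fun i => (-ω) i = 1) =
        Finset.univ.filter fun i => ¬ ω i = 1 := by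
      ext i
      rcases Int.units_eq_one_or (ω i) with hi | hi <;> simp [hi]
    have := Finset.card_filter_add_card_filter_not (s := Finset.univ) fun i => ω i = 1
    rw [Finset.card_univ, Fintype.card_fin, ← hneg] at this
    lia

variable [NormedSpace ℝ Y]

theorem BeckConvex.mul (hθ : BeckConvex Y P θ) (hη : BeckConvex Y Q η) (hη0 : 0 < η) :
    BeckConvex Y (P * Q) (θ * η) := by
  intro z hz
  rcases Nat.eq_zero_or_pos Q with rfl | hQ
  · exact ⟨1, by simp⟩
  have hηQ : 0 < η * Q := by positivity
  choose δ hδ using fun i : Fin P => hη (fun j => z (finProdFinEquiv (i, j))) fun j => hz _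
  obtain ⟨ε, hε⟩ := hθ (fun i => (η * Q)⁻¹ • ∑ j, δ i j • z (finProdFinEquiv (i, j))) fun i => by
    rw [norm_smul, norm_inv, Real.norm_of_nonneg hηQ.le, inv_mul_le_iff₀ hηQ, mul_one]
    exact hδ i
  let ω (k : Fin (P * Q)) : ℤˣ :=
    ε (finProdFinEquiv.symm k).1 * δ (finProdFinEquiv.symm k).1 (finProdFinEquiv.symm k).2
  have hsum : ∑ k, ω k • z k =
      (η * Q) • ∑ i, ε i • (η * Q)⁻¹ • ∑ j, δ i j • z (finProdFinEquiv (i, j)) := by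
    rw [← Equiv.sum_comp finProdFinEquiv, Fintype.sum_prod_type, Finset.smul_sum]
    refine Finset.sum_congr rfl fun i _ => ?_
    rw [smul_comm (ε i), smul_inv_smul₀ hηQ.ne', Finset.smul_sum]
    simp only [ω, Equiv.symm_apply_apply, mul_smul]
  refine ⟨ω, ?_⟩
  calc ‖∑ k, ω k • z k‖ ≤ η * Q * (θ * P) := by
        rw [hsum, norm_smul, Real.norm_of_nonneg hηQ.le]
        gcongr
    _ = θ * η * (P * Q : ℕ) := by push_cast; ring

theorem BeckConvex.two_pow (h : BeckConvex Y (2 ^ n) θ) (hθ : 0 < θ) (j : ℕ) :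
    BeckConvex Y (2 ^ j) (θ ^ (j / n)) := by
  have hmul (k : ℕ) : BeckConvex Y (2 ^ (n * k)) (θ ^ k) := by
    induction k with
    | zero => simpa using beckConvex_one 1
    | succ k ih =>
      rw [mul_add, mul_one, pow_add, pow_succ]
      exact ih.mul h hθ
  have := (beckConvex_one (Y := Y) (2 ^ (j % n))).mul (hmul (j / n)) (pow_pos hθ _)
  rwa [← pow_add, Nat.mod_add_div, one_mul] at this

/-- Halving the number of terms: keep those to which a balanced choice of signs gives the sign that
occurs at most half of the time. -/
theorem BeckConvex.exists_mem_averages_half (h : BeckConvex Y (2 * P) θ) (hP : P ≠ 0)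
    {A : Set Y} (hA : A ⊆ closedBall 0 1) {x : Y} (hx : x ∈ averages (2 * P) A) :
    ∃ y ∈ averages P A, ‖x - y‖ ≤ θ := by
  obtain ⟨v, hv, rfl⟩ := hx
  have hv1 (j) : ‖v j‖ ≤ 1 := by
    obtain h0 | hvA := Set.mem_insert_iff.1 (hv j trivial)
    · simp [h0]
    · simpa using hA hvA
  obtain ⟨ω, hcard, hω⟩ := h.exists_card_filter_le hv1
  refine ⟨_, smul_sum_mem_averages hcard fun j _ => hv j trivial, ?_⟩
  have hsum : ∑ j, v j + ∑ j, ω j • v j =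
      (2 : ℝ) • ∑ j ∈ Finset.univ.filter (fun j => ω j = 1), v j := by
    rw [← Finset.sum_add_distrib, Finset.sum_filter, Finset.smul_sum]
    refine Finset.sum_congr rfl fun j _ => ?_
    rcases Int.units_eq_one_or (ω j) with hj | hj <;> simp [hj, two_smul]
  have hP' : (0 : ℝ) < (2 * P : ℕ) := by positivity
  have hdiff : ((2 * P : ℕ) : ℝ)⁻¹ • ∑ j, v j -
      (P : ℝ)⁻¹ • ∑ j ∈ Finset.univ.filter (fun j => ω j = 1), v j =
      -(((2 * P : ℕ) : ℝ)⁻¹ • ∑ j, ω j • v j) := by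
    have : (P : ℝ)⁻¹ = ((2 * P : ℕ) : ℝ)⁻¹ * 2 := by push_cast; field_simp
    rw [this, mul_smul, ← hsum, smul_add]
    abel
  rw [hdiff, norm_neg, norm_smul, norm_inv, Real.norm_of_nonneg hP'.le, inv_mul_le_iff₀ hP']
  linarith

end BeckConvex

section Maurey

open Metric

variable {Y : Type*} [NormedAddCommGroup Y] [NormedSpace ℝ Y] {n : ℕ} {θ : ℝ} {A : Set Y} {x : Y}

theorem norm_smul_sub_floor_smul_le {w : ℝ} (hw : 0 ≤ w) {P : ℕ} (hP : P ≠ 0) :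
    ‖w • x - (P : ℝ)⁻¹ • ⌊w * P⌋₊ • x‖ ≤ ‖x‖ / P := by
  have hP' : (0 : ℝ) < P := by positivity
  have hfloor := Nat.floor_le (mul_nonneg hw hP'.le)
  have hlt := (Nat.lt_floor_add_one (w * P)).le
  have hfactor : w • x - (P : ℝ)⁻¹ • ⌊w * P⌋₊ • x = ((w * P - ⌊w * P⌋₊) / P) • x := by
    rw [← Nat.cast_smul_eq_nsmul ℝ, smul_smul, ← sub_smul]
    congr 1
    field_simp
  rw [hfactor, norm_smul, Real.norm_of_nonneg (div_nonneg (by linarith) hP'.le), div_mul_eq_mul_div]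
  gcongr
  exact mul_le_of_le_one_left (norm_nonneg x) (by linarith)

/-- Each point of a convex combination is repeated a number of times proportional to its weight,
rounded down. -/
theorem exists_forall_mem_averages_norm_sub_le (hx : x ∈ convexHull ℝ A) :
    ∃ C : ℝ, ∀ P : ℕ, P ≠ 0 → ∃ y ∈ averages P A, ‖x - y‖ ≤ C / P := by
  obtain ⟨ι, _, w, z, hw0, hw1, hz, rfl⟩ := mem_convexHull_iff_exists_fintype.1 hx
  refine ⟨∑ i, ‖z i‖, fun P hP => ?_⟩
  let copies : Finset (Σ _ : ι, ℕ) := Finset.univ.sigma fun i => Finset.range ⌊w i * P⌋₊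
  have hcard : copies.card ≤ P := by
    have hle : ∑ i, (⌊w i * P⌋₊ : ℝ) ≤ P := calc
      ∑ i, (⌊w i * P⌋₊ : ℝ) ≤ ∑ i, w i * P :=
        Finset.sum_le_sum fun i _ => Nat.floor_le (mul_nonneg (hw0 i) P.cast_nonneg)
      _ = P := by rw [← Finset.sum_mul, hw1, one_mul]
    simp only [copies, Finset.card_sigma, Finset.card_range]
    exact_mod_cast hle
  refine ⟨_, smul_sum_mem_averages (f := fun a : Σ _ : ι, ℕ => z a.1) hcard
    fun a _ => Set.mem_insert_of_mem _ (hz a.1), ?_⟩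
  simp only [copies, Finset.sum_sigma, Finset.sum_const, Finset.card_range]
  rw [Finset.smul_sum, ← Finset.sum_sub_distrib, Finset.sum_div]
  exact norm_sum_le_of_le _ fun i _ => norm_smul_sub_floor_smul_le (hw0 i) hP

theorem BeckConvex.exists_mem_averages_two_pow (h : BeckConvex Y (2 ^ n) θ) (hθ : 0 < θ)
    (hA : A ⊆ closedBall 0 1) (k d : ℕ) (hx : x ∈ averages (2 ^ (k + d)) A) :
    ∃ y ∈ averages (2 ^ k) A, ‖x - y‖ ≤ ∑ i ∈ Finset.range d, θ ^ ((i + (k + 1)) / n) := by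
  induction d generalizing x with
  | zero => exact ⟨x, hx, by simp⟩
  | succ d ih =>
    rw [← add_assoc, pow_succ'] at hx
    have hd := h.two_pow hθ (k + d + 1)
    rw [pow_succ'] at hd
    obtain ⟨y, hy, hxy⟩ := hd.exists_mem_averages_half (by positivity) hA hx
    obtain ⟨y', hy', hyy'⟩ := ih hy
    refine ⟨y', hy', (norm_sub_le_norm_sub_add_norm_sub x y y').trans ?_⟩
    rw [Finset.sum_range_succ, add_comm, show d + (k + 1) = k + d + 1 by ring]
    exact add_le_add hyy' hxy

theorem summable_pow_div (hn : n ≠ 0) (hθ0 : 0 ≤ θ) (hθ1 : θ < 1) :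
    Summable fun i : ℕ => θ ^ (i / n) := by
  have : NeZero n := ⟨hn⟩
  rw [← (Nat.divModEquiv n).symm.summable_iff]
  have hprod : Summable fun p : ℕ × Fin n => θ ^ p.1 * (1 : ℝ) :=
    (summable_geometric_of_lt_one hθ0 hθ1).mul_of_nonneg (g := fun _ : Fin n => (1 : ℝ))
      Summable.of_finite (fun _ => pow_nonneg hθ0 _) fun _ => zero_le_one
  refine hprod.congr fun p => ?_
  have hdiv : (p.1 * n + p.2 : ℕ) / n = p.1 := by
    rw [mul_comm, Nat.mul_add_div (Nat.pos_of_ne_zero hn), Nat.div_eq_of_lt p.2.2, add_zero]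
  simp [Nat.divModEquiv, hdiv]

theorem exists_forall_sum_pow_div_lt (hn : n ≠ 0) (hθ0 : 0 ≤ θ) (hθ1 : θ < 1) {δ : ℝ}
    (hδ : 0 < δ) : ∃ k, ∀ d, ∑ i ∈ Finset.range d, θ ^ ((i + (k + 1)) / n) < δ := by
  have hs := summable_pow_div hn hθ0 hθ1
  have ht := (tendsto_sum_nat_add fun i => θ ^ (i / n)).comp (Filter.tendsto_add_atTop_nat 1)
  obtain ⟨k, hk⟩ := (ht.eventually (gt_mem_nhds hδ)).exists
  exact ⟨k, fun d => (((summable_nat_add_iff (k + 1)).2 hs).sum_le_tsum (Finset.range d)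
    fun i _ => pow_nonneg hθ0 _).trans_lt hk⟩

/-- Maurey's empirical method: write a convex combination approximately as an average of `2 ^ J`
terms for a huge `J`, then halve the number of terms repeatedly; the errors form a geometric
series. -/
theorem exists_forall_hasAverageApprox (hn : n ≠ 0) (hθ0 : 0 < θ) (hθ1 : θ < 1) {δ : ℝ}
    (hδ : 0 < δ) : ∃ m : ℕ, m ≠ 0 ∧ ∀ (Y : Type*) [NormedAddCommGroup Y] [NormedSpace ℝ Y],
      BeckConvex Y (2 ^ n) θ → HasAverageApprox m (closedBall (0 : Y) 1) (closedBall 0 δ) := by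
  obtain ⟨k, hk⟩ := exists_forall_sum_pow_div_lt hn hθ0.le hθ1 (half_pos hδ)
  refine ⟨2 ^ k, by positivity, fun Y _ _ hY A hA x hx => ?_⟩
  obtain ⟨C, hC⟩ := exists_forall_mem_averages_norm_sub_le hx
  obtain ⟨d, hd⟩ : ∃ d : ℕ, C / (2 ^ (k + d) : ℕ) < δ / 2 := by
    have hlim : Filter.Tendsto (fun d => C / ((2 ^ (k + d) : ℕ) : ℝ)) Filter.atTop (nhds 0) := by
      refine tendsto_const_nhds.div_atTop (tendsto_natCast_atTop_atTop.comp ?_)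
      exact (tendsto_pow_atTop_atTop_of_one_lt one_lt_two).comp
        (Filter.tendsto_add_atTop_nat k |>.congr fun d => add_comm d k)
    exact (hlim.eventually (gt_mem_nhds (half_pos hδ))).exists
  obtain ⟨y, hy, hxy⟩ := hC _ (pow_ne_zero (k + d) two_ne_zero)
  obtain ⟨y', hy', hyy'⟩ := hY.exists_mem_averages_two_pow hθ0 hA k d hy
  refine ⟨y', hy', mem_closedBall_zero_iff.2 ?_⟩
  linarith [norm_sub_le_norm_sub_add_norm_sub x y y', hk d]

end Maurey

section cubeMean

variable {n : ℕ}

theorem cubeMean_mono {f g : (Fin n → ℤˣ) → ℝ} (h : ∀ ω, f ω ≤ g ω) : cubeMean f ≤ cubeMean g :=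
  mul_le_mul_of_nonneg_left (Finset.sum_le_sum fun ω _ => h ω) (by positivity)

theorem cubeMean_const (n : ℕ) (c : ℝ) : cubeMean (fun _ : Fin n → ℤˣ => c) = c := by
  simp [cubeMean]

theorem cubeMean_add (f g : (Fin n → ℤˣ) → ℝ) :
    cubeMean (fun ω => f ω + g ω) = cubeMean f + cubeMean g := by
  simp only [cubeMean, Finset.sum_add_distrib, smul_add]

theorem cubeMean_const_mul (c : ℝ) (f : (Fin n → ℤˣ) → ℝ) :
    cubeMean (fun ω => c * f ω) = c * cubeMean f := by
  simp only [cubeMean, ← Finset.mul_sum, smul_eq_mul, mul_left_comm]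

theorem cubeMean_mul_left (ω : Fin n → ℤˣ) (f : (Fin n → ℤˣ) → ℝ) :
    cubeMean (fun ω' => f (ω * ω')) = cubeMean f := by
  simp only [cubeMean]
  rw [← Equiv.sum_comp (Equiv.mulLeft ω) f]
  rfl

theorem cubeMean_comp_sum_rademacher_succ (φ : ℝ → ℝ) :
    cubeMean (fun ω : Fin (n + 1) → ℤˣ => φ (∑ i, rademacher i ω)) =
      cubeMean fun ω : Fin n → ℤˣ =>
        (φ (1 + ∑ i, rademacher i ω) + φ (-1 + ∑ i, rademacher i ω)) / 2 := by
  have hsum : ∑ ω : Fin (n + 1) → ℤˣ, φ (∑ i, rademacher i ω) =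
      ∑ ω : Fin n → ℤˣ, (φ (1 + ∑ i, rademacher i ω) + φ (-1 + ∑ i, rademacher i ω)) := by
    rw [← Equiv.sum_comp (Fin.consEquiv fun _ => ℤˣ), Fintype.sum_prod_type, Finset.sum_comm]
    refine Finset.sum_congr rfl fun ω _ => ?_
    rw [UnitsInt.univ, Finset.sum_pair (by decide)]
    simp [Fin.sum_univ_succ, rademacher]
  rw [cubeMean, cubeMean, hsum, ← Finset.sum_div, smul_eq_mul, smul_eq_mul]
  field_simp
  ring

theorem cubeMean_sum_rademacher_sq (n : ℕ) :
    cubeMean (fun ω : Fin n → ℤˣ => (∑ i, rademacher i ω) ^ 2) = n := by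
  induction n with
  | zero => simp [cubeMean]
  | succ n ih =>
    have hstep (t : ℝ) : ((1 + t) ^ 2 + (-1 + t) ^ 2) / 2 = t ^ 2 + 1 := by ring
    rw [cubeMean_comp_sum_rademacher_succ fun t => t ^ 2]
    simp only [hstep, cubeMean_add, cubeMean_const, ih, Nat.cast_succ]

theorem cubeMean_sum_rademacher_pow_four (n : ℕ) :
    cubeMean (fun ω : Fin n → ℤˣ => (∑ i, rademacher i ω) ^ 4) = 3 * n ^ 2 - 2 * n := by
  induction n with
  | zero => simp [cubeMean]
  | succ n ih =>
    have hstep (t : ℝ) : ((1 + t) ^ 4 + (-1 + t) ^ 4) / 2 = t ^ 4 + 6 * t ^ 2 + 1 := by ring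
    rw [cubeMean_comp_sum_rademacher_succ fun t => t ^ 4]
    simp only [hstep, cubeMean_add, cubeMean_const_mul, cubeMean_const, ih,
      cubeMean_sum_rademacher_sq, Nat.cast_succ]
    ring

theorem twelve_mul_sq_sub_pow_four_le {a : ℝ} (ha : 0 ≤ a) (t : ℝ) :
    12 * a ^ 2 * t ^ 2 - t ^ 4 ≤ 16 * a ^ 3 * |t| := by
  have hnonneg : 0 ≤ |t| * (|t| - 2 * a) ^ 2 * (|t| + 4 * a) := by positivity
  rw [← sq_abs t, ← Even.pow_abs (by decide : Even 4) t]
  linarith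

/-- Khintchine's inequality: the even polynomial `12 n t² - t⁴`, whose mean is explicit, lies below
a multiple of `|t|` and touches it at `t = 2 √n`. -/
theorem sqrt_div_two_le_cubeMean_abs_sum_rademacher (n : ℕ) :
    √n / 2 ≤ cubeMean fun ω : Fin n → ℤˣ => |∑ i, rademacher i ω| := by
  rcases Nat.eq_zero_or_pos n with rfl | hn
  · simp [cubeMean]
  set a := √(n : ℝ)
  have ha : 0 < a := by positivity
  have hsq : (n : ℝ) = a ^ 2 := (Real.sq_sqrt n.cast_nonneg).symm
  have hmean := cubeMean_mono fun ω : Fin n → ℤˣ =>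
    (neg_add_eq_sub _ _).trans_le (twelve_mul_sq_sub_pow_four_le ha.le (∑ i, rademacher i ω))
  simp only [neg_eq_neg_one_mul (_ ^ 4)] at hmean
  rw [cubeMean_add, cubeMean_const_mul, cubeMean_const_mul, cubeMean_const_mul,
    cubeMean_sum_rademacher_sq, cubeMean_sum_rademacher_pow_four, hsq] at hmean
  refine le_of_mul_le_mul_left (hmean.trans' ?_) (by positivity : 0 < 16 * a ^ 3)
  nlinarith [pow_pos ha 4, pow_pos ha 2]

theorem cubeMean_norm_le_cubeL2Norm {Y : Type*} [NormedAddCommGroup Y] (f : (Fin n → ℤˣ) → Y) :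
    cubeMean (fun ω => ‖f ω‖) ≤ cubeL2Norm f := by
  have hcs := sq_sum_le_card_mul_sum_sq (s := Finset.univ) (f := fun ω => ‖f ω‖)
  simp only [Finset.card_univ, Fintype.card_pi, Finset.prod_const, Fintype.card_fin,
    Fintype.card_units_int, Nat.cast_pow, Nat.cast_ofNat] at hcs
  refine Real.le_sqrt_of_sq_le ?_
  simp only [cubeMean, smul_eq_mul]
  rw [mul_pow, inv_pow, inv_mul_le_iff₀ (by positivity)]
  refine hcs.trans_eq ?_
  field_simp

end cubeMean

section RademacherBounded

theorem rademacherProj_eq_cubeMean {n : ℕ} {Y : Type*} [AddCommGroup Y] [Module ℝ Y]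
    (f : (Fin n → ℤˣ) → Y) (ω : Fin n → ℤˣ) :
    rademacherProj f ω = cubeMean fun ω' => (∑ i, rademacher i (ω * ω')) • f ω' := by
  have hmul (i : Fin n) (ω') : rademacher i (ω * ω') = rademacher i ω * rademacher i ω' := by
    simp [rademacher]
  simp only [rademacherProj, cubeMean, smul_comm _ ((2 ^ n : ℝ)⁻¹), ← Finset.smul_sum, hmul,
    Finset.sum_smul, mul_smul]
  congr 1
  simp only [Finset.smul_sum]
  exact Finset.sum_comm

variable {Y : Type*} [NormedAddCommGroup Y] [NormedSpace ℝ Y] {n : ℕ} {C : ℝ}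

theorem cubeMean_rademacherProj_apply (g : (Fin n → ℤˣ) → StrongDual ℝ Y)
    (f : (Fin n → ℤˣ) → Y) :
    cubeMean (fun ω => rademacherProj g ω (f ω)) =
      cubeMean fun ω => g ω (rademacherProj f ω) := by
  simp only [rademacherProj_eq_cubeMean, cubeMean, smul_apply, sum_apply, map_smul, map_sum]
  simp only [← Finset.smul_sum]
  rw [Finset.sum_comm]
  simp only [mul_comm]

/-- The Rademacher projections are bounded by `C` from `L_∞` to `L_1`, in all dimensions. This
weak form of `K`-convexity passes to the dual space. -/
def RademacherBounded (Y : Type*) [NormedAddCommGroup Y] [NormedSpace ℝ Y] (C : ℝ) : Prop :=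
  ∀ (n : ℕ) (f : (Fin n → ℤˣ) → Y), (∀ ω, ‖f ω‖ ≤ 1) →
    cubeMean (fun ω => ‖rademacherProj f ω‖) ≤ C

theorem rademacherBounded_of_kConvexityConst_le {κ : ℝ≥0} (h : kConvexityConst Y ≤ κ) :
    RademacherBounded Y (κ + 1) := by
  have hlt : kConvexityConst Y < ((κ + 1 : ℝ≥0) : ℝ≥0∞) :=
    h.trans_lt (ENNReal.coe_lt_coe.2 (lt_add_one κ))
  obtain ⟨C, hC, hCκ⟩ : ∃ (C : ℝ≥0) (_ : ∀ (n : ℕ) (f : (Fin n → ℤˣ) → Y),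
      cubeL2Norm (rademacherProj f) ≤ C * cubeL2Norm f), (C : ℝ≥0∞) < (κ + 1 : ℝ≥0) := by
    simpa only [kConvexityConst, iInf_lt_iff] using hlt
  intro n f hf
  have hf1 : cubeL2Norm f ≤ 1 := by
    rw [cubeL2Norm, Real.sqrt_le_one, ← cubeMean_const n 1]
    exact cubeMean_mono fun ω => pow_le_one₀ (norm_nonneg _) (hf ω)
  calc cubeMean (fun ω => ‖rademacherProj f ω‖) ≤ cubeL2Norm (rademacherProj f) :=
        cubeMean_norm_le_cubeL2Norm _
    _ ≤ C * cubeL2Norm f := hC n f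
    _ ≤ C * 1 := by gcongr
    _ ≤ κ + 1 := by simpa using NNReal.coe_le_coe.2 (ENNReal.coe_lt_coe.1 hCκ).le

theorem exists_norm_le_one_lt_apply {u : StrongDual ℝ Y} {r : ℝ} (hr : r < ‖u‖) :
    ∃ x, ‖x‖ ≤ 1 ∧ r < u x := by
  obtain ⟨x, hx, hlt⟩ := u.exists_lt_apply_of_lt_opNorm hr
  rcases lt_abs.1 hlt with hpos | hneg
  · exact ⟨x, hx.le, hpos⟩
  · exact ⟨-x, by simpa using hx.le, by simpa using hneg⟩

theorem RademacherBounded.dual (h : RademacherBounded Y C) :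
    RademacherBounded (StrongDual ℝ Y) (C + 1) := by
  intro n g hg
  choose x hx1 hx using fun ω =>
    exists_norm_le_one_lt_apply (sub_one_lt ‖rademacherProj g ω‖)
  calc cubeMean (fun ω => ‖rademacherProj g ω‖)
      ≤ cubeMean (fun ω => rademacherProj g ω (x ω) + 1) :=
        cubeMean_mono fun ω => by linarith [hx ω]
    _ = cubeMean (fun ω => g ω (rademacherProj x ω)) + 1 := by
        rw [cubeMean_add, cubeMean_const, cubeMean_rademacherProj_apply]
    _ ≤ cubeMean (fun ω => ‖rademacherProj x ω‖) + 1 := by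
        gcongr
        refine cubeMean_mono fun ω => (Real.le_norm_self _).trans ?_
        simpa using (g ω).le_of_opNorm_le (hg ω) (rademacherProj x ω)
    _ ≤ C + 1 := by gcongr; exact h n x hx1

/-- Vectors all of whose signed sums are almost maximal span `ℓ₁` with constant `2`: the norming
functional of `∑ i, ε i • z i` must be at least `1 / 2` at every `ε i • z i`. -/
theorem half_sum_abs_le_norm_sum_smul {ι : Type*} [Fintype ι] {z : ι → Y} (hz : ∀ i, ‖z i‖ ≤ 1)
    (h : ∀ ε : ι → ℤˣ, (Fintype.card ι : ℝ) - 1 / 2 < ‖∑ i, ε i • z i‖) (a : ι → ℝ) :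
    (∑ i, |a i|) / 2 ≤ ‖∑ i, a i • z i‖ := by
  let ε (i : ι) : ℤˣ := if 0 ≤ a i then 1 else -1
  have ha (i) (y : Y) : a i • y = |a i| • ε i • y := by
    by_cases hi : 0 ≤ a i
    · simp [ε, hi, abs_of_nonneg hi]
    · simp [ε, hi, abs_of_neg (not_le.1 hi), Units.neg_smul]
  obtain ⟨φ, hφ1, hφ⟩ := exists_dual_vector'' ℝ (∑ i, ε i • z i)
  have hle (i) : φ (ε i • z i) ≤ 1 := by
    have hnorm : ‖ε i • z i‖ ≤ 1 := by
      rcases Int.units_eq_one_or (ε i) with hi | hi <;> simpa [hi, Units.neg_smul] using hz i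
    simpa using (Real.le_norm_self _).trans (φ.le_of_opNorm_le_of_le hφ1 hnorm)
  have hdefect : ∑ i, (1 - φ (ε i • z i)) ≤ 1 / 2 := by
    rw [map_sum] at hφ
    have := h ε
    simp only [Finset.sum_sub_distrib, Finset.sum_const, Finset.card_univ, nsmul_eq_mul, mul_one,
      hφ, RCLike.ofReal_real_eq_id, id]
    linarith
  have hge (i) : 1 / 2 ≤ φ (ε i • z i) := by
    have := Finset.single_le_sum (f := fun j => 1 - φ (ε j • z j))
      (fun j _ => sub_nonneg.2 (hle j)) (Finset.mem_univ i)
    linarith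
  calc (∑ i, |a i|) / 2 = ∑ i, |a i| * (1 / 2) := by rw [← Finset.sum_mul]; ring
    _ ≤ ∑ i, |a i| * φ (ε i • z i) :=
        Finset.sum_le_sum fun i _ => mul_le_mul_of_nonneg_left (hge i) (abs_nonneg _)
    _ = φ (∑ i, a i • z i) := by simp only [map_sum, ha, map_smul, smul_eq_mul]
    _ ≤ ‖∑ i, a i • z i‖ :=
        (Real.le_norm_self _).trans (φ.le_of_opNorm_le_of_le hφ1 le_rfl |>.trans_eq (one_mul _))

theorem RademacherBounded.beckConvex (h : RademacherBounded Y C) (hn : 4 * C < √n) :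
    BeckConvex Y (2 ^ n) (1 - 1 / (2 * 2 ^ n)) := by
  by_contra hcon
  simp only [BeckConvex, not_forall, not_exists, not_le] at hcon
  obtain ⟨z, hz, hlarge⟩ := hcon
  obtain ⟨e⟩ : Nonempty ((Fin n → ℤˣ) ≃ Fin (2 ^ n)) :=
    ⟨Fintype.equivFinOfCardEq (by simp)⟩
  have hℓ₁ := half_sum_abs_le_norm_sum_smul (z := z ∘ e) (fun _ => hz _) fun ε => by
    refine (hlarge (ε ∘ e.symm)).trans_eq' ?_ |>.trans_eq ?_
    · simp
      field_simp
    · rw [← Equiv.sum_comp e]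
      simp
  have hproj (ω) : √n / 4 ≤ ‖rademacherProj (z ∘ e) ω‖ := by
    have hmean := sqrt_div_two_le_cubeMean_abs_sum_rademacher n
    rw [← cubeMean_mul_left ω] at hmean
    simp only [rademacherProj_eq_cubeMean, cubeMean] at hmean ⊢
    have := hℓ₁ fun ω' => ∑ i, rademacher i (ω * ω')
    rw [norm_smul, Real.norm_of_nonneg (by positivity)]
    calc √n / 4 ≤ ((2 ^ n)⁻¹ * ∑ ω' : Fin n → ℤˣ, |∑ i, rademacher i (ω * ω')|) / 2 := by
          rw [smul_eq_mul] at hmean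
          linarith
      _ ≤ _ := by
          rw [mul_div_assoc]
          gcongr
  have := (cubeMean_mono hproj).trans (h n (z ∘ e) fun _ => hz _)
  rw [cubeMean_const] at this
  linarith

end RademacherBounded

section dualPolar

open Metric

variable {X : Type*} [NormedAddCommGroup X] [NormedSpace ℝ X] {T : Set X}

/-- The dilate `s • T°` of the polar of `T`, as a subset of the dual of `X`. -/
abbrev dualPolar (s : ℝ) (T : Set X) : Set (StrongDual ℝ X) :=
  scaledPolar (topDualPairing ℝ X).flip s T

theorem scaledPolar_closedBall (s : ℝ) :
    scaledPolar (topDualPairing ℝ X) s (closedBall 0 1) = closedBall 0 s := by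
  ext x
  rw [mem_closedBall_zero_iff]
  constructor
  · intro h
    obtain ⟨u, hu, hux⟩ := exists_dual_vector'' ℝ x
    simpa [hux] using h u (by simpa using hu)
  · intro h u hu
    rw [mem_closedBall_zero_iff] at hu
    simpa using (u.le_of_opNorm_le hu x).trans (by simpa using h)

theorem exists_norm_le_apply_sub_apply_le (hTconv : Convex ℝ T) (hTneg : ∀ x ∈ T, -x ∈ T)
    {α ρ : ℝ} (hα : 0 ≤ α) (hρ : 0 < ρ) {u : StrongDual ℝ X}
    (hu : u ∈ dualPolar α (T ∩ closedBall 0 ρ)) {t : X} (ht : t ∈ T) :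
    ∃ w : StrongDual ℝ X, ‖w‖ ≤ α / ρ ∧ u t - w t ≤ α := by
  rcases le_or_gt ‖t‖ ρ with htρ | htρ
  · exact ⟨0, by simpa using div_nonneg hα hρ.le, by
      simpa using (abs_le.1 (hu t ⟨ht, by simpa using htρ⟩)).2⟩
  · have ht0 : 0 < ‖t‖ := hρ.trans htρ
    have hmem : (ρ / ‖t‖) • t ∈ T ∩ closedBall 0 ρ := by
      refine ⟨((balanced_iff_neg_mem hTconv).2 hTneg).smul_mem ?_ ht, ?_⟩
      · rw [norm_div, norm_norm, Real.norm_of_nonneg hρ.le]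
        exact div_le_one_of_le₀ htρ.le ht0.le
      · rw [mem_closedBall_zero_iff, norm_smul, norm_div, norm_norm, Real.norm_of_nonneg hρ.le,
          div_mul_cancel₀ _ ht0.ne']
    obtain ⟨v, hv, hvt⟩ := exists_dual_vector'' ℝ t
    refine ⟨(α / ρ) • v, ?_, ?_⟩
    · rw [norm_smul, Real.norm_of_nonneg (by positivity)]
      exact mul_le_of_le_one_right (by positivity) hv
    · have hut : ρ / ‖t‖ * u t ≤ α := by simpa using (abs_le.1 (hu _ hmem)).2
      have hle : u t ≤ α / ρ * ‖t‖ := by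
        rw [div_mul_eq_mul_div, div_le_iff₀ ht0] at hut
        rw [div_mul_eq_mul_div, le_div_iff₀ hρ]
        linarith
      simp only [smul_apply, smul_eq_mul, hvt, RCLike.ofReal_real_eq_id, id]
      linarith

theorem exists_norm_le_sub_mem_dualPolar (hTconv : Convex ℝ T) (hTneg : ∀ x ∈ T, -x ∈ T)
    {α ρ : ℝ} (hα : 0 ≤ α) (hρ : 0 < ρ) {u : StrongDual ℝ X}
    (hu : u ∈ dualPolar α (T ∩ closedBall 0 ρ)) :
    ∃ w : StrongDual ℝ X, ‖w‖ ≤ α / ρ ∧ u - w ∈ dualPolar α T := by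
  let A : Set (WeakDual ℝ X) := WeakDual.toStrongDual ⁻¹' closedBall 0 (α / ρ)
  have hAconv : Convex ℝ A :=
    (convex_closedBall (0 : StrongDual ℝ X) (α / ρ)).linear_preimage
      (WeakDual.toStrongDual : WeakDual ℝ X ≃ₗ[ℝ] StrongDual ℝ X).toLinearMap
  have hcont (t : X) : Continuous fun w : WeakDual ℝ X => u t - w t :=
    continuous_const.sub (WeakDual.eval_continuous t)
  obtain ⟨w, hw, hwT⟩ := exists_forall_le_of_forall_exists_le (A := A) (B := T) (r := α)
    (f := fun w t => u t - w t) ⟨0, by simpa [A] using div_nonneg hα hρ.le⟩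
    (WeakDual.isCompact_closedBall 0 (α / ρ)) hAconv hTconv
    (fun t _ => (hcont t).continuousOn.lowerSemicontinuousOn)
    (fun t _ => by
      refine ConvexOn.quasiconvexOn ⟨hAconv, fun w _ v _ a b _ _ hab => le_of_eq ?_⟩
      have happ : (a • w + b • v) t = a * w t + b * v t := rfl
      simp only [happ, smul_eq_mul]
      linear_combination -u t * hab)
    (fun w _ => (u.continuous.sub w.continuous).continuousOn.upperSemicontinuousOn)
    (fun w _ => ((u.toLinearMap - w.toLinearMap).concaveOn hTconv).quasiconcaveOn)
    fun t ht => by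
      obtain ⟨w, hw, hwt⟩ := exists_norm_le_apply_sub_apply_le hTconv hTneg hα hρ hu ht
      exact ⟨StrongDual.toWeakDual w, by simpa [A] using hw, hwt⟩
  refine ⟨WeakDual.toStrongDual w, by simpa [A] using hw, fun t ht => abs_le'.2 ⟨?_, ?_⟩⟩
  · simpa using hwT t ht
  · simpa [add_comm] using hwT (-t) (hTneg t ht)

theorem closedBall_subset_dualPolar {r : ℝ} (hT : T ⊆ closedBall 0 r) (s : ℝ) :
    closedBall 0 s ⊆ dualPolar (s * r) T := fun u hu x hx => by
  rw [mem_closedBall_zero_iff] at hu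
  have hxr : ‖x‖ ≤ r := by simpa using hT hx
  calc |u x| ≤ ‖u‖ * ‖x‖ := u.le_opNorm x
    _ ≤ s * r := by gcongr; exact (norm_nonneg u).trans hu

variable {m R : ℕ} {σ : ℝ}

theorem sepNum_closedBall_le_sepNum_dualPolar_pow (hm : m ≠ 0) (hR : R ≠ 0) (hσ : 0 < σ)
    (happrox : HasAverageApprox m (closedBall (0 : X) 1) (closedBall 0 (2 / R)))
    (hT : T ⊆ closedBall 0 (R * σ)) :
    sepNum T (closedBall 0 (8 * σ)) ≤
      sepNum (closedBall 0 1) (dualPolar σ T) ^ ((2 * R + 2) * m) := by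
  have hpos : 0 < R * σ := by positivity
  have hscale (s : ℝ) : (R * σ) • closedBall (0 : X) s = closedBall 0 (R * σ * s) := by
    rw [smul_closedBall' hpos.ne', smul_zero, Real.norm_of_nonneg hpos.le]
  have happroxT : HasAverageApprox m T
      (scaledPolar (topDualPairing ℝ X) (2 * σ) (closedBall 0 1)) := by
    refine (happrox.smul hpos.ne').mono (by simpa [hscale] using hT) ?_
    rw [hscale, scaledPolar_closedBall, show R * σ * (2 / R) = 2 * σ by field_simp]
  rw [← scaledPolar_closedBall]
  refine sepNum_scaledPolar_flip_le_pow (β := (topDualPairing ℝ X).flip) hm hσ happroxT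
    ⟨0, by simp⟩ (convex_closedBall 0 1) (fun u hu => by simpa using hu) fun x hx u hu => ?_
  simpa using closedBall_subset_dualPolar hT 1 hu x hx

theorem sepNum_dualPolar_le_sepNum_closedBall_pow (hm : m ≠ 0) (hR : R ≠ 0) (hσ : 0 < σ)
    (happrox : HasAverageApprox m (closedBall (0 : StrongDual ℝ X) 1) (closedBall 0 (2 / R)))
    (hT : T ⊆ closedBall 0 (R * σ)) (hTne : T.Nonempty) (hTconv : Convex ℝ T)
    (hTneg : ∀ x ∈ T, -x ∈ T) :
    sepNum (closedBall 0 1) (dualPolar (8 * σ) T) ≤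
      sepNum T (closedBall 0 σ) ^ ((2 * R + 2) * m) := by
  rw [← scaledPolar_closedBall σ]
  refine sepNum_scaledPolar_flip_le_pow hm hσ (happrox.mono subset_rfl ?_) hTne hTconv hTneg
    fun u hu x hx => ?_
  · have hsub := closedBall_subset_dualPolar hT (2 / R)
    rwa [show 2 / R * (R * σ) = 2 * σ by field_simp] at hsub
  · simpa using closedBall_subset_dualPolar hT 1 hu x hx

end dualPolar

section scales

open Metric

variable {X : Type*} [NormedAddCommGroup X] [NormedSpace ℝ X] {T : Set X} {s t ρ : ℝ}

theorem sepNum_closedBall_le_mul (hTconv : Convex ℝ T) (hTneg : ∀ x ∈ T, -x ∈ T) (hs : 0 ≤ s)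
    (hρ : 0 ≤ ρ) : sepNum T (closedBall 0 s) ≤
      sepNum T (closedBall 0 (2 * ρ)) * sepNum (T ∩ closedBall 0 ρ) (closedBall 0 (s / 2)) := by
  refine (sepNum_le_mul (D' := closedBall 0 (2 * ρ)) (by simpa using hs) (by simpa using hρ)
    fun x hx => by simpa using hx).trans ?_
  gcongr
  refine sepNum_le_of_map (fun x => (2⁻¹ : ℝ) • x) (by simp; linarith) ?_ fun x _ y _ h => ?_
  · rintro _ ⟨⟨x, hx, y, hy, rfl⟩, hxy⟩
    refine ⟨?_, ?_⟩
    · simpa [smul_sub, sub_eq_add_neg] using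
        hTconv hx (hTneg y hy) (by norm_num : (0 : ℝ) ≤ 2⁻¹) (by norm_num) (by norm_num)
    · simp only [mem_closedBall_zero_iff, norm_smul, norm_inv, Real.norm_ofNat] at hxy ⊢
      linarith
  · simp only [← smul_sub, mem_closedBall_zero_iff, norm_smul, norm_inv, Real.norm_ofNat] at h ⊢
    linarith

theorem sepNum_dualPolar_le_mul (hTconv : Convex ℝ T) (hTneg : ∀ x ∈ T, -x ∈ T) (hs : 0 < s)
    (hρ : 0 < ρ) : sepNum (closedBall 0 1) (dualPolar s T) ≤
      sepNum (closedBall 0 1) (dualPolar (s / 4) (T ∩ closedBall 0 ρ)) *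
        sepNum (closedBall 0 1) (dualPolar (2 * ρ) T) := by
  refine (sepNum_le_mul (D' := dualPolar (s / 4) (T ∩ closedBall 0 ρ))
    (zero_mem_scaledPolar hs.le) (zero_mem_scaledPolar (by positivity))
    fun _ => neg_mem_scaledPolar).trans ?_
  gcongr
  choose! w hw huw using fun (u) (hu : u ∈ dualPolar (s / 4) (T ∩ closedBall 0 ρ)) =>
    exists_norm_le_sub_mem_dualPolar hTconv hTneg (by positivity) hρ hu
  have hc : 0 < 4 * ρ / s := by positivity
  refine sepNum_le_of_map (fun u => (4 * ρ / s) • w u) (zero_mem_scaledPolar (by positivity))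
    ?_ ?_
  · rintro u ⟨-, hu⟩
    rw [mem_closedBall_zero_iff, norm_smul, Real.norm_of_nonneg hc.le]
    calc 4 * ρ / s * ‖w u‖ ≤ 4 * ρ / s * (s / 4 / ρ) := by gcongr; exact hw u hu
      _ = 1 := by field_simp
  · rintro u ⟨-, hu⟩ u' ⟨-, hu'⟩ h
    rw [← smul_sub (4 * ρ / s) (w u), show 2 * ρ = 4 * ρ / s * (s / 2) by field_simp; norm_num,
      smul_mem_scaledPolar_iff hc] at h
    have hmem := add_mem_scaledPolar (sub_mem_scaledPolar (huw u hu) (huw u' hu')) h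
    rwa [show s / 4 + s / 4 + s / 2 = s by ring, sub_sub_sub_comm, sub_add_cancel] at hmem

theorem sepNum_closedBall_mul_le (hTconv : Convex ℝ T) (ht : 0 ≤ t) (htρ : t ≤ 4 * ρ) :
    sepNum T (closedBall 0 (4 * ρ)) * sepNum (T ∩ closedBall 0 ρ) (closedBall 0 t) ≤
      sepNum T (closedBall 0 (t / 4)) := by
  refine sepNum_mul_le (fun x y => (2⁻¹ : ℝ) • x + (2⁻¹ : ℝ) • y) (by simpa using by linarith)
    (fun x hx y hy => hTconv hx hy.1 (by norm_num) (by norm_num) (by norm_num)) ?_ ?_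
  · intro x _ x' _ y hy y' hy' h
    have hyy : ‖y - y'‖ ≤ 2 * ρ := by
      have hle := norm_sub_le y y'
      have hyn := mem_closedBall_zero_iff.1 hy.2
      have hyn' := mem_closedBall_zero_iff.1 hy'.2
      linarith
    rw [add_sub_add_comm, ← smul_sub, ← smul_sub, ← smul_add, mem_closedBall_zero_iff, norm_smul,
      norm_inv, Real.norm_ofNat] at h
    rw [mem_closedBall_zero_iff]
    have hxx := norm_sub_le (x - x' + (y - y')) (y - y')
    rw [add_sub_cancel_right] at hxx
    linarith
  · intro x _ y _ y' _ h
    simp only [add_sub_add_left_eq_sub, ← smul_sub, mem_closedBall_zero_iff, norm_smul, norm_inv,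
      Real.norm_ofNat] at h ⊢
    linarith

theorem sepNum_dualPolar_mul_le (ht : 0 < t) (htρ : t ≤ 4 * ρ) :
    sepNum (closedBall 0 1) (dualPolar t (T ∩ closedBall 0 ρ)) *
      sepNum (closedBall 0 1) (dualPolar (4 * ρ) T) ≤
        sepNum (closedBall 0 1) (dualPolar (t / 4) T) := by
  have hρ : 0 < ρ := by linarith
  have hc : 0 < t / (8 * ρ) := by positivity
  have hc2 : t / (8 * ρ) ≤ 2⁻¹ := by
    rw [div_le_iff₀ (by positivity)]
    linarith
  refine sepNum_mul_le (fun u v => (2⁻¹ : ℝ) • u + (t / (8 * ρ)) • v)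
    (zero_mem_scaledPolar (by positivity)) ?_ ?_ ?_
  · intro u hu v hv
    rw [mem_closedBall_zero_iff] at hu hv ⊢
    calc ‖(2⁻¹ : ℝ) • u + (t / (8 * ρ)) • v‖ ≤ 2⁻¹ * ‖u‖ + t / (8 * ρ) * ‖v‖ := by
          refine (norm_add_le _ _).trans_eq ?_
          rw [norm_smul, norm_smul, Real.norm_of_nonneg hc.le, norm_inv, Real.norm_ofNat]
      _ ≤ 2⁻¹ * 1 + 2⁻¹ * 1 := by gcongr
      _ = 1 := by norm_num
  · intro u _ u' _ v hv v' hv' h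
    have hsmall (y) (hy : y ∈ closedBall (0 : StrongDual ℝ X) 1) :
        (t / (8 * ρ)) • y ∈ dualPolar (t / 8) (T ∩ closedBall 0 ρ) := by
      rw [show t / 8 = t / (8 * ρ) * (1 * ρ) by field_simp, smul_mem_scaledPolar_iff hc]
      exact closedBall_subset_dualPolar Set.inter_subset_right 1 hy
    have hmem := sub_mem_scaledPolar (s := t / 4) (fun x hx => h x hx.1)
      (sub_mem_scaledPolar (hsmall v hv) (hsmall v' hv'))
    rw [add_sub_add_comm, add_sub_cancel_right, ← smul_sub (2⁻¹ : ℝ) u,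
      show t / 4 + (t / 8 + t / 8) = 2⁻¹ * t by ring] at hmem
    exact (smul_mem_scaledPolar_iff (by norm_num)).1 hmem
  · intro u _ v _ v' _ h
    rw [add_sub_add_left_eq_sub, ← smul_sub (t / (8 * ρ)) v,
      show t / 4 = t / (8 * ρ) * (2 * ρ) by field_simp; norm_num, smul_mem_scaledPolar_iff hc] at h
    exact scaledPolar_mono (by linarith) h

end scales

section recursion

/-- The bound that telescopes over the scales is `f s ≤ (g (2 * s / c) * g (2 * s)) ^ b`. -/
theorem le_pow_of_scale_recursion {f g h : ℝ → ℕ∞} {b : ℕ} {c r : ℝ} (hc : 1 < c)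
    (hf : ∀ s, 0 < s → r ≤ s → f s ≤ 1) (hg : ∀ s, 1 ≤ g s) (hanti : AntitoneOn g (Set.Ioi 0))
    (hfh : ∀ s, 0 < s → f s ≤ f (c * s) * h s ^ b)
    (hhg : ∀ s, 0 < s → h s * g (2 * c * s) ≤ g (2 * s / c)) {s : ℝ} (hs : 0 < s) :
    f s ≤ g (2 * s / c) ^ (2 * b) := by
  have : 0 < c := one_pos.trans hc
  have claim (n : ℕ) : ∀ s, 0 < s → r ≤ c ^ n * s → f s ≤ (g (2 * s / c) * g (2 * s)) ^ b := by
    induction n with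
    | zero =>
      intro s hs hrs
      exact (hf s hs (by simpa using hrs)).trans
        (one_le_pow_of_one_le' (one_le_mul (hg _) (hg _)) b)
    | succ n ih =>
      intro s hs hrs
      have hcs := ih (c * s) (by positivity) (by rwa [← mul_assoc, ← pow_succ])
      rw [show 2 * (c * s) / c = 2 * s by field_simp, ← mul_assoc] at hcs
      calc f s ≤ f (c * s) * h s ^ b := hfh s hs
        _ ≤ (g (2 * s) * g (2 * c * s)) ^ b * h s ^ b := by gcongr
        _ = (h s * g (2 * c * s) * g (2 * s)) ^ b := by rw [← mul_pow]; congr 1; ring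
        _ ≤ (g (2 * s / c) * g (2 * s)) ^ b := by gcongr; exact hhg s hs
  obtain ⟨n, hn⟩ := pow_unbounded_of_one_lt (r / s) hc
  calc f s ≤ (g (2 * s / c) * g (2 * s)) ^ b := claim n s hs ((div_le_iff₀ hs).1 hn.le)
    _ ≤ (g (2 * s / c) * g (2 * s / c)) ^ b := by
        gcongr
        exact hanti (Set.mem_Ioi.2 (by positivity)) (Set.mem_Ioi.2 (by positivity))
          (div_le_self (by positivity) hc.le)
    _ = g (2 * s / c) ^ (2 * b) := by rw [pow_mul, sq]

end recursion

section unbounded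

theorem sepNum_eq_top_of_forall_exists {E : Type*} [AddCommGroup E] [Module ℝ E] {K D : Set E}
    {s : ℝ} (hs : 0 ≤ s) (hK : Convex ℝ K) (h0K : (0 : E) ∈ K) (h0D : (0 : E) ∈ D)
    (h : ∀ r, ∃ x ∈ K, ∃ R, r < R ∧ ∀ c : ℝ, c • x ∈ D → |c| * R ≤ s) : sepNum K D = ⊤ := by
  refine ENat.eq_top_iff_forall_ge.2 fun n => ?_
  obtain ⟨x, hx, R, hR, hxD⟩ := h (n * s)
  rw [← Finset.card_range n]
  refine card_le_sepNum_of_family (f := fun i => ((i : ℝ) / n) • x) h0D (fun i hi => ?_)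
    fun i hi j _ hij hmem => ?_
  · have hin : (i : ℝ) ≤ n := by exact_mod_cast (Finset.mem_range.1 hi).le
    exact hK.smul_mem_of_zero_mem h0K hx ⟨by positivity, div_le_one_of_le₀ hin (by positivity)⟩
  · have hn : (0 : ℝ) < n := by exact_mod_cast (Nat.zero_le i).trans_lt (Finset.mem_range.1 hi)
    have hR0 : 0 ≤ R := (by positivity : 0 ≤ n * s).trans hR.le
    have hone : (1 : ℝ) ≤ |(i : ℝ) - j| := by
      exact_mod_cast Int.one_le_abs (sub_ne_zero.2 (Nat.cast_injective.ne hij))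
    have hle := hxD _ (by rwa [← sub_smul] at hmem)
    rw [← sub_div, abs_div, Nat.abs_cast, div_mul_eq_mul_div, div_le_iff₀ hn] at hle
    linarith [le_mul_of_one_le_left hR0 hone]

open Metric

variable {X : Type*} [NormedAddCommGroup X] [NormedSpace ℝ X] {T : Set X} {s : ℝ}

theorem sepNum_closedBall_eq_top (hTconv : Convex ℝ T) (h0 : (0 : X) ∈ T)
    (hT : ¬ Bornology.IsBounded T) (hs : 0 ≤ s) : sepNum T (closedBall 0 s) = ⊤ := by
  refine sepNum_eq_top_of_forall_exists hs hTconv h0 (by simpa using hs) fun r => ?_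
  simp only [isBounded_iff_forall_norm_le, not_exists, not_forall, not_le] at hT
  obtain ⟨x, hx, hrx⟩ := hT r
  exact ⟨x, hx, ‖x‖, hrx, fun c hc => by simpa [norm_smul] using hc⟩

theorem sepNum_dualPolar_eq_top (hT : ¬ Bornology.IsBounded T) (hs : 0 ≤ s) :
    sepNum (closedBall 0 1) (dualPolar s T) = ⊤ := by
  refine sepNum_eq_top_of_forall_exists hs (convex_closedBall 0 1) (by simp)
    (zero_mem_scaledPolar hs) fun r => ?_
  simp only [isBounded_iff_forall_norm_le, not_exists, not_forall, not_le] at hT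
  obtain ⟨x, hx, hrx⟩ := hT r
  obtain ⟨u, hu, hux⟩ := exists_dual_vector'' ℝ x
  exact ⟨u, by simpa using hu, ‖x‖, hrx, fun c hc => by simpa [hux, abs_mul] using hc x hx⟩

end unbounded

section entropyDuality

open Metric

theorem sepNum_closedBall_le_one {X : Type*} [NormedAddCommGroup X] {T : Set X} {r s : ℝ}
    (hT : T ⊆ closedBall 0 r) (hs : 0 ≤ s) (hrs : 2 * r ≤ s) :
    sepNum T (closedBall 0 s) ≤ 1 := by
  refine (sepNum_le_one_iff (by simpa using hs) fun x hx => by simpa using hx).2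
    fun x hx y hy => ?_
  have hxr := mem_closedBall_zero_iff.1 (hT hx)
  have hyr := mem_closedBall_zero_iff.1 (hT hy)
  rw [mem_closedBall_zero_iff]
  linarith [norm_sub_le x y]

variable {X : Type*} [NormedAddCommGroup X] [NormedSpace ℝ X] {T : Set X} {m : ℕ} {r s : ℝ}

theorem sepNum_dualPolar_le_one (hT : T ⊆ closedBall 0 r) (hs : 0 ≤ s) (hrs : 2 * r ≤ s) :
    sepNum (closedBall 0 1) (dualPolar s T) ≤ 1 := by
  refine (sepNum_le_one_iff (zero_mem_scaledPolar hs) fun _ => neg_mem_scaledPolar).2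
    fun u hu v hv => scaledPolar_mono (by linarith) (sub_mem_scaledPolar
      (closedBall_subset_dualPolar hT 1 hu) (closedBall_subset_dualPolar hT 1 hv))

theorem sepNum_closedBall_le_pow_of_isBounded (hm : m ≠ 0)
    (happrox : HasAverageApprox m (closedBall (0 : X) 1) (closedBall 0 (2 / (4096 : ℕ))))
    (hTconv : Convex ℝ T) (hTneg : ∀ x ∈ T, -x ∈ T) (hT : Bornology.IsBounded T) (hs : 0 < s) :
    sepNum T (closedBall 0 s) ≤
      sepNum (closedBall 0 1) (dualPolar (s / 128) T) ^ (2 * ((2 * 4096 + 2) * m)) := by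
  -- `T` is truncated at radius `ρ = 128 * s`, and the duality is used at level `σ = s / 32`,
  -- so that `ρ = 4096 * σ`.
  obtain ⟨r, hr⟩ := hT.subset_closedBall 0
  rw [show s / 128 = 2 * s / 256 by ring]
  refine le_pow_of_scale_recursion (f := fun s => sepNum T (closedBall 0 s))
    (g := fun s => sepNum (closedBall 0 1) (dualPolar s T))
    (h := fun s => sepNum (closedBall 0 1) (dualPolar (s / 32) (T ∩ closedBall 0 (128 * s))))
    (by norm_num) (fun s hs => sepNum_closedBall_le_one hr hs.le)
    (fun s => one_le_sepNum ⟨0, by simp⟩)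
    (fun s hs t _ hst => sepNum_mono (zero_mem_scaledPolar (le_of_lt hs)) subset_rfl
      (scaledPolar_mono hst)) (fun s hs => ?_) (fun s hs => ?_) hs
  · calc sepNum T (closedBall 0 s)
      _ ≤ sepNum T (closedBall 0 (2 * (128 * s))) *
            sepNum (T ∩ closedBall 0 (128 * s)) (closedBall 0 (s / 2)) :=
          sepNum_closedBall_le_mul hTconv hTneg hs.le (by positivity)
      _ ≤ sepNum T (closedBall 0 (256 * s)) *
            sepNum (T ∩ closedBall 0 (128 * s)) (closedBall 0 (8 * (s / 32))) := by
          rw [← mul_assoc, show (2 * 128 : ℝ) = 256 by norm_num]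
          gcongr
          exact sepNum_mono (mem_closedBall_self (by positivity)) subset_rfl
            (closedBall_subset_closedBall (by linarith))
      _ ≤ _ := by
          gcongr
          refine sepNum_closedBall_le_sepNum_dualPolar_pow hm (by norm_num) (by positivity) happrox
            (Set.inter_subset_right.trans (closedBall_subset_closedBall ?_))
          push_cast
          linarith
  · have hle := sepNum_dualPolar_mul_le (X := X) (T := T) (t := s / 32) (ρ := 128 * s)
      (by positivity) (by linarith)
    rwa [show 4 * (128 * s) = 2 * 256 * s by ring, show s / 32 / 4 = 2 * s / 256 by ring] at hle

theorem sepNum_dualPolar_le_pow_of_isBounded (hm : m ≠ 0)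
    (happrox : HasAverageApprox m (closedBall (0 : StrongDual ℝ X) 1)
      (closedBall 0 (2 / (4096 : ℕ))))
    (h0 : (0 : X) ∈ T) (hTconv : Convex ℝ T) (hTneg : ∀ x ∈ T, -x ∈ T)
    (hT : Bornology.IsBounded T) (hs : 0 < s) :
    sepNum (closedBall 0 1) (dualPolar s T) ≤
      sepNum T (closedBall 0 (s / 128)) ^ (2 * ((2 * 4096 + 2) * m)) := by
  obtain ⟨r, hr⟩ := hT.subset_closedBall 0
  rw [show s / 128 = 2 * s / 256 by ring]
  refine le_pow_of_scale_recursion (f := fun s => sepNum (closedBall 0 1) (dualPolar s T))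
    (g := fun s => sepNum T (closedBall 0 s))
    (h := fun s => sepNum (T ∩ closedBall 0 (128 * s)) (closedBall 0 (s / 32)))
    (by norm_num) (fun s hs => sepNum_dualPolar_le_one hr hs.le) (fun s => one_le_sepNum ⟨0, h0⟩)
    (fun s hs t _ hst => sepNum_mono (by simpa using le_of_lt hs) subset_rfl
      (closedBall_subset_closedBall hst)) (fun s hs => ?_) (fun s hs => ?_) hs
  · calc sepNum (closedBall 0 1) (dualPolar s T)
      _ ≤ sepNum (closedBall 0 1) (dualPolar (s / 4) (T ∩ closedBall 0 (128 * s))) *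
            sepNum (closedBall 0 1) (dualPolar (2 * (128 * s)) T) :=
          sepNum_dualPolar_le_mul hTconv hTneg hs (by positivity)
      _ = sepNum (closedBall 0 1) (dualPolar (256 * s) T) *
            sepNum (closedBall 0 1) (dualPolar (8 * (s / 32)) (T ∩ closedBall 0 (128 * s))) := by
          rw [mul_comm]; congr 3 <;> ring
      _ ≤ _ := by
          gcongr
          refine sepNum_dualPolar_le_sepNum_closedBall_pow hm (by norm_num) (by positivity) happrox
            (Set.inter_subset_right.trans (closedBall_subset_closedBall ?_))
            ⟨0, h0, by simpa using hs.le⟩ (hTconv.inter (convex_closedBall _ _))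
            fun x hx => ⟨hTneg x hx.1, by simpa using hx.2⟩
          push_cast
          linarith
  · have hle := sepNum_closedBall_mul_le (t := s / 32) (ρ := 128 * s) hTconv (by positivity)
      (by linarith)
    rwa [mul_comm, show 4 * (128 * s) = 2 * 256 * s by ring,
      show s / 32 / 4 = 2 * s / 256 by ring] at hle

end entropyDuality

section packingNumber

variable {E : Type*} [AddCommGroup E] [TopologicalSpace E] {K D : Set E}

theorem packingNumber_le_iff {N : ℕ∞} : packingNumber K D ≤ N ↔ ∀ S : Finset E, (S : Set E) ⊆ K →
    (S : Set E).PairwiseDisjoint (fun x => interior (x +ᵥ D)) → (S.card : ℕ∞) ≤ N := by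
  simp only [packingNumber, iSup_le_iff]
  refine ⟨fun h S hS hd => by simpa using h S hS hd, fun h S hS hd => ?_⟩
  refine ENat.forall_natCast_le_iff_le.1 fun n hn => ?_
  obtain ⟨t, htS, htn⟩ := Set.exists_subset_encard_eq hn
  have htfin : t.Finite := Set.finite_of_encard_eq_coe htn
  rw [← htn, htfin.encard_eq_coe_toFinset_card]
  exact h _ (by simpa using htS.trans hS) (by simpa using hd.subset htS)

theorem card_le_packingNumber {S : Finset E} (hK : (S : Set E) ⊆ K)
    (hD : (S : Set E).PairwiseDisjoint fun x => interior (x +ᵥ D)) :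
    (S.card : ℕ∞) ≤ packingNumber K D :=
  packingNumber_le_iff.1 le_rfl S hK hD

variable [Module ℝ E]

theorem packingNumber_le_sepNum [IsTopologicalAddGroup E] [ContinuousConstSMul ℝ E]
    (hDconv : Convex ℝ D) (hDneg : ∀ x ∈ D, -x ∈ D) (h0 : D ∈ nhds 0) :
    packingNumber K D ≤ sepNum K D := by
  have hhalf (d) (hd : d ∈ D) : (1 / 2 : ℝ) • d ∈ interior D := by
    have hmem := hDconv.combo_interior_self_mem_interior (mem_interior_iff_mem_nhds.2 h0) hd
      (a := 1 / 2) (b := 1 / 2) (by norm_num) (by norm_num) (by norm_num)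
    rwa [smul_zero, zero_add] at hmem
  refine packingNumber_le_iff.2 fun S hSK hSD => card_le_sepNum hSK fun x hx y hy hxy hmem => ?_
  have hmid_x : midpoint ℝ x y ∈ interior (x +ᵥ D) := by
    rw [interior_vadd]
    refine ⟨_, hhalf _ (hDneg _ hmem), ?_⟩
    simp only [midpoint_eq_smul_add, invOf_eq_inv, vadd_eq_add]
    module
  have hmid_y : midpoint ℝ x y ∈ interior (y +ᵥ D) := by
    rw [interior_vadd]
    refine ⟨_, hhalf _ hmem, ?_⟩
    simp only [midpoint_eq_smul_add, invOf_eq_inv, vadd_eq_add]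
    module
  exact Set.disjoint_left.1 (hSD hx hy hxy) hmid_x hmid_y

theorem sepNum_two_smul_le_packingNumber (hDconv : Convex ℝ D) (hDneg : ∀ x ∈ D, -x ∈ D) :
    sepNum K ((2 : ℝ) • D) ≤ packingNumber K D := by
  refine sepNum_le_iff.2 fun S hSK hSD => card_le_packingNumber hSK fun x hx y hy hxy => ?_
  refine Set.disjoint_left.2 fun z hzx hzy => hSD hx hy hxy ?_
  obtain ⟨d, hd, rfl⟩ := interior_subset hzx
  obtain ⟨d', hd', hdd'⟩ := interior_subset hzy
  have hsub : x - y = d' + -d := by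
    simp only [vadd_eq_add] at hdd'
    rw [← sub_eq_add_neg, sub_eq_sub_iff_add_eq_add, ← hdd', add_comm]
  rw [hsub, ← one_add_one_eq_two, hDconv.add_smul zero_le_one zero_le_one, one_smul]
  exact Set.add_mem_add hd' (hDneg d hd)

end packingNumber

section logTwo

theorem logTwo_le_mul_of_le_pow {N M : ℕ∞} {b : ℕ} (h : N ≤ M ^ b) :
    logTwo N ≤ ((b : ℝ) : EReal) * logTwo M := by
  have hlog2 : (0 : EReal) ≤ (Real.log 2 : ℝ) := by exact_mod_cast (Real.log_pos one_lt_two).le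
  have hcast : (N : ℝ≥0∞) ≤ (M : ℝ≥0∞) ^ b := by exact_mod_cast ENat.toENNReal_le.2 h
  rw [logTwo, logTwo, EReal.mul_div, EReal.coe_natCast, ← ENNReal.log_pow]
  exact EReal.div_le_div_right_of_nonneg hlog2 (ENNReal.log_monotone hcast)

theorem inv_mul_logTwo_le_of_le_pow {N M : ℕ∞} {b : ℕ} (hb : b ≠ 0) (h : N ≤ M ^ b) :
    (((b : ℝ)⁻¹ : ℝ) : EReal) * logTwo N ≤ logTwo M := by
  have hb0 : (0 : ℝ) < b := by positivity
  calc (((b : ℝ)⁻¹ : ℝ) : EReal) * logTwo N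
      ≤ (((b : ℝ)⁻¹ : ℝ) : EReal) * (((b : ℝ) : EReal) * logTwo M) :=
        mul_le_mul_of_nonneg_left (logTwo_le_mul_of_le_pow h)
          (by exact_mod_cast (inv_pos.2 hb0).le)
    _ = logTwo M := by
        rw [← mul_assoc, ← EReal.coe_mul, inv_mul_cancel₀ hb0.ne', EReal.coe_one, one_mul]

end logTwo

section packingDuality

open Metric (closedBall closedBall_mem_nhds)

variable {X : Type*} [NormedAddCommGroup X] [NormedSpace ℝ X] {T : Set X} {m : ℕ} {s : ℝ}

theorem smul_polar_eq_dualPolar (hs : 0 < s) : s • StrongDual.polar ℝ T = dualPolar s T := by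
  have hpolar : StrongDual.polar ℝ T = dualPolar 1 T := by
    ext u
    simp [StrongDual.mem_polar_iff, scaledPolar]
  rw [hpolar, smul_scaledPolar hs, mul_one]

theorem dualPolar_mem_nhds_zero (hT : Bornology.IsBounded T) (hs : 0 < s) :
    dualPolar s T ∈ nhds 0 := by
  obtain ⟨r, hr0, hr⟩ := hT.subset_closedBall_lt 0 0
  refine Filter.mem_of_superset (closedBall_mem_nhds 0 (div_pos hs hr0)) ?_
  simpa [div_mul_cancel₀ s hr0.ne'] using closedBall_subset_dualPolar hr (s / r)

theorem sepNum_closedBall_le_packingNumber_closedBall {K : Set X} (hs : 0 < s) :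
    sepNum K (closedBall 0 s) ≤ packingNumber K (closedBall 0 (s / 2)) := by
  have hle := sepNum_two_smul_le_packingNumber (K := K) (convex_closedBall (0 : X) (s / 2))
    (by simp)
  rwa [smul_closedBall _ _ (by positivity), smul_zero, Real.norm_two,
    mul_div_cancel₀ s two_ne_zero] at hle

theorem sepNum_dualPolar_le_packingNumber_dualPolar {K : Set (StrongDual ℝ X)} :
    sepNum K (dualPolar s T) ≤ packingNumber K (dualPolar (s / 2) T) := by
  have hle := sepNum_two_smul_le_packingNumber (K := K) (D := dualPolar (s / 2) T)
    convex_scaledPolar fun _ => neg_mem_scaledPolar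
  rwa [smul_scaledPolar two_pos, mul_div_cancel₀ s two_ne_zero] at hle

theorem packingNumber_closedBall_le_pow (hm : m ≠ 0)
    (happrox : HasAverageApprox m (closedBall (0 : X) 1) (closedBall 0 (2 / (4096 : ℕ))))
    (hTconv : Convex ℝ T) (hTneg : ∀ x ∈ T, -x ∈ T) (hs : 0 < s) :
    packingNumber T (closedBall 0 s) ≤
      packingNumber (closedBall 0 1) (dualPolar (s / 256) T) ^ (2 * ((2 * 4096 + 2) * m)) := by
  have hdual := sepNum_dualPolar_le_packingNumber_dualPolar (K := closedBall 0 1) (T := T)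
    (s := s / 128)
  rw [div_div, show (128 * 2 : ℝ) = 256 by norm_num] at hdual
  by_cases hT : Bornology.IsBounded T
  · calc packingNumber T (closedBall 0 s)
      _ ≤ sepNum T (closedBall 0 s) :=
          packingNumber_le_sepNum (convex_closedBall 0 s) (by simp) (closedBall_mem_nhds 0 hs)
      _ ≤ sepNum (closedBall 0 1) (dualPolar (s / 128) T) ^ (2 * ((2 * 4096 + 2) * m)) :=
          sepNum_closedBall_le_pow_of_isBounded hm happrox hTconv hTneg hT hs
      _ ≤ _ := by gcongr
  · rw [sepNum_dualPolar_eq_top hT (by positivity), top_le_iff] at hdual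
    simp [hdual, ENat.top_pow, hm]

theorem packingNumber_dualPolar_le_pow (hm : m ≠ 0)
    (happrox : HasAverageApprox m (closedBall (0 : StrongDual ℝ X) 1)
      (closedBall 0 (2 / (4096 : ℕ))))
    (h0 : (0 : X) ∈ T) (hTconv : Convex ℝ T) (hTneg : ∀ x ∈ T, -x ∈ T) (hs : 0 < s) :
    packingNumber (closedBall 0 1) (dualPolar s T) ≤
      packingNumber T (closedBall 0 (s / 256)) ^ (2 * ((2 * 4096 + 2) * m)) := by
  have hprimal := sepNum_closedBall_le_packingNumber_closedBall (K := T) (s := s / 128)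
    (by positivity)
  rw [div_div, show (128 * 2 : ℝ) = 256 by norm_num] at hprimal
  by_cases hT : Bornology.IsBounded T
  · calc packingNumber (closedBall 0 1) (dualPolar s T)
      _ ≤ sepNum (closedBall 0 1) (dualPolar s T) :=
          packingNumber_le_sepNum convex_scaledPolar (fun _ => neg_mem_scaledPolar)
            (dualPolar_mem_nhds_zero hT hs)
      _ ≤ sepNum T (closedBall 0 (s / 128)) ^ (2 * ((2 * 4096 + 2) * m)) :=
          sepNum_dualPolar_le_pow_of_isBounded hm happrox h0 hTconv hTneg hT hs
      _ ≤ _ := by gcongr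
  · rw [sepNum_closedBall_eq_top hTconv h0 hT (by positivity), top_le_iff] at hprimal
    simp [hprimal, ENat.top_pow, hm]

end packingDuality

theorem exists_hasAverageApprox_of_kConvexityConst_le (κ : ℝ≥0) {δ : ℝ} (hδ : 0 < δ) :
    ∃ m : ℕ, m ≠ 0 ∧ ∀ (X : Type*) [NormedAddCommGroup X] [NormedSpace ℝ X],
      kConvexityConst X ≤ (κ : ℝ≥0∞) →
        HasAverageApprox m (Metric.closedBall (0 : X) 1) (Metric.closedBall 0 δ) ∧
        HasAverageApprox m (Metric.closedBall (0 : StrongDual ℝ X) 1) (Metric.closedBall 0 δ) := by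
  obtain ⟨k, hk⟩ := exists_nat_gt (4 * ((κ : ℝ) + 1 + 1))
  have hk0 : 0 < k := by
    have : (0 : ℝ) < k := lt_of_le_of_lt (by positivity) hk
    exact_mod_cast this
  have hsqrt : √((k ^ 2 : ℕ) : ℝ) = k := by
    rw [Nat.cast_pow, Real.sqrt_sq (Nat.cast_nonneg k)]
  have hpos : (0 : ℝ) < 1 / (2 * 2 ^ k ^ 2) := by positivity
  have hlt : (1 : ℝ) / (2 * 2 ^ k ^ 2) < 1 := by
    rw [div_lt_one (by positivity)]
    linarith [one_le_pow₀ (one_le_two (α := ℝ)) (n := k ^ 2)]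
  obtain ⟨m, hm, h⟩ := exists_forall_hasAverageApprox (n := k ^ 2)
    (θ := 1 - 1 / (2 * 2 ^ k ^ 2)) (by positivity) (by linarith) (by linarith) hδ
  refine ⟨m, hm, fun X _ _ hX => ?_⟩
  have hR := rademacherBounded_of_kConvexityConst_le hX
  exact ⟨h X (hR.beckConvex (by rw [hsqrt]; linarith)),
    h _ (hR.dual.beckConvex (by rwa [hsqrt]))⟩

theorem mainTheorem4 (κ : ℝ≥0) :
    ∃ a b : ℝ, 1 ≤ a ∧ 1 ≤ b ∧
      ∀ (X : Type*) [NormedAddCommGroup X] [NormedSpace ℝ X],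
        kConvexityConst X ≤ (κ : ℝ≥0∞) →
        ∀ T : Set X, T.Nonempty → Convex ℝ T → (∀ x ∈ T, -x ∈ T) →
        ∀ ε : ℝ, 0 < ε →
          ((b⁻¹ : ℝ) : EReal) *
              logTwo (packingNumber (StrongDual.polar ℝ (Metric.closedBall (0 : X) 1))
                ((a * ε) • StrongDual.polar ℝ T)) ≤
            logTwo (packingNumber T (ε • Metric.closedBall (0 : X) 1)) ∧
          logTwo (packingNumber T (ε • Metric.closedBall (0 : X) 1)) ≤
            (b : EReal) *
              logTwo (packingNumber (StrongDual.polar ℝ (Metric.closedBall (0 : X) 1))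
                ((a⁻¹ * ε) • StrongDual.polar ℝ T)) := by
  obtain ⟨m, hm, happrox⟩ := exists_hasAverageApprox_of_kConvexityConst_le κ
    (δ := 2 / (4096 : ℕ)) (by norm_num)
  have hb : 2 * ((2 * 4096 + 2) * m) ≠ 0 := by positivity
  refine ⟨256, (2 * ((2 * 4096 + 2) * m) : ℕ), by norm_num,
    by exact_mod_cast Nat.one_le_iff_ne_zero.2 hb, fun X _ _ hX T hTne hTconv hTneg ε hε => ?_⟩
  obtain ⟨happroxX, happroxDual⟩ := happrox X hX
  have h0 : (0 : X) ∈ T := ((balanced_iff_neg_mem hTconv).2 hTneg).zero_mem hTne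
  have hball : ε • Metric.closedBall (0 : X) 1 = Metric.closedBall 0 ε := by
    rw [smul_unitClosedBall, Real.norm_of_nonneg hε.le]
  rw [NormedSpace.polar_closedBall one_pos, inv_one, hball,
    smul_polar_eq_dualPolar (by positivity), smul_polar_eq_dualPolar (by positivity)]
  constructor
  · refine inv_mul_logTwo_le_of_le_pow hb ?_
    simpa using packingNumber_dualPolar_le_pow hm happroxDual h0 hTconv hTneg
      (mul_pos (by norm_num : (0 : ℝ) < 256) hε)
  · refine logTwo_le_mul_of_le_pow ?_
    rw [inv_mul_eq_div]
    exact packingNumber_closedBall_le_pow hm happroxX hTconv hTneg hε
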